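/- Let $Z$ be a random variable with values in $\{0,1,2,\dots\}$ and ${\bf P}[Z=0]=0$, and let $d:=\min\{k\ge 1 : {\bf P}[Z=k]>0\}$. Consider the Galton--Watson tree in which the offspring numbers of all individuals are i.i.d. copies of $Z$ (a random rooted tree without leaves). For $\beta>0$, the $\beta$-biased random walk $(X_n)_{n\ge 0}$ on a tree $\omega$ is the Markov chain started from the root which, from a vertex $x$ other than the root with $k$ children, moves to the ancestor of $x$ with probability $\frac{1}{1+\beta k}$ and to each child of $x$ with probability $\frac{\beta}{1+\beta k}$, and from the root moves to a uniformly chosen child; its law is denoted $P^\omega$. Let $\mathbb P={\bf P}\times P^\omega$ be the averaged law (semi-direct product), and let $|x|$ be the distance of $x$ from the root. The speed is the constant $v(\beta)$, depending only on $\beta$ and the law of $Z$, such that $\lim_{n\to\infty}|X_n|/n=v(\beta)$ $\mathbb P$-almost surely. Then, for every $\beta\ge 717/d$, the speed $v(\beta)$ exists, and $v$ is strictly increasing on $[717/d,\infty)$: if $717/d\le\beta<\beta'$, then $v(\beta)<v(\beta')$. -/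

import Mathlib

open MeasureTheory ProbabilityTheory Filter Topology Finset
open scoped ENNReal NNReal

namespace BiasedWalk

/-- Individuals are labelled by finite words of natural numbers (Ulam-Harris labels), the most recent
letter first: the root is `[]`, the children of `x` are `0 :: x, …, (k - 1) :: x`, where `k` is the
number of children of `x`, the ancestor of `a :: x` is `x`, and `|x|` is `x.length`. -/
abbrev Vertex : Type := List ℕ

instance instMeasurableSpaceVertex : MeasurableSpace Vertex := ⊤

instance instDiscreteMeasurableSpaceVertex : DiscreteMeasurableSpace Vertex := ⟨fun _ => trivial⟩

/-- A tree, given by the number of children `ω x` of every potential individual `x`. The vertices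
of the tree are the words that are reached from the root by passing to children. -/
abbrev Tree : Type := Vertex → ℕ

/-- The law of the Galton-Watson tree with offspring law `p`: the numbers of children are
independent with law `p`. -/
noncomputable def galtonWatson (p : PMF ℕ) : Measure Tree :=
  Measure.infinitePi fun _ : Vertex => p.toMeasure

instance instIsProbabilityMeasureGaltonWatson (p : PMF ℕ) :
    IsProbabilityMeasure (galtonWatson p) := by
  unfold galtonWatson; infer_instance

/-- The minimal degree `min {k ≥ 1 : P[Z = k] > 0}` of the offspring law `p`. -/
noncomputable def minDegree (p : PMF ℕ) : ℕ := sInf {k : ℕ | 1 ≤ k ∧ 0 < p k}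

/-- The law of the next position of the `β`-biased walk on `ω` from the vertex `x`. From the root all
children are equally likely; from another vertex with `k` children the ancestor has probability
`1 / (1 + β k)` and each child has probability `β / (1 + β k)`. (At a root without children,
which does not occur for a leafless tree, the walk stays put.) -/
noncomputable def step (β : ℝ≥0) (ω : Tree) : Vertex → Measure Vertex
  | [] => if ω [] = 0 then Measure.dirac []
      else ∑ i ∈ range (ω []), ((ω [] : ℝ≥0)⁻¹ : ℝ≥0) • Measure.dirac [i]
  | a :: x => (1 / (1 + β * ω (a :: x)) : ℝ≥0) • Measure.dirac x +
      ∑ i ∈ range (ω (a :: x)), (β / (1 + β * ω (a :: x)) : ℝ≥0) • Measure.dirac (i :: a :: x)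

instance instIsProbabilityMeasureStep (β : ℝ≥0) (ω : Tree) (x : Vertex) :
    IsProbabilityMeasure (step β ω x) := by
  constructor
  cases x with
  | nil =>
    by_cases h : ω [] = 0
    · simp [step, h]
    · have h' : (ω [] : ℝ≥0∞) ≠ 0 := by exact_mod_cast h
      have h2 : (ω [] : ℝ≥0) ≠ 0 := by exact_mod_cast h
      simp only [step, h, if_false, Measure.finsetSum_apply, Measure.smul_apply, measure_univ,
        sum_const, card_range, nsmul_eq_mul, ENNReal.smul_def, smul_eq_mul, mul_one]
      rw [ENNReal.coe_inv h2]
      exact ENNReal.mul_inv_cancel h' (by simp)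
  | cons a x =>
    simp only [step, Measure.add_apply, Measure.finsetSum_apply, Measure.smul_apply, measure_univ,
        sum_const, card_range, nsmul_eq_mul, ENNReal.smul_def, smul_eq_mul, mul_one]
    have h : (1 + β * ω (a :: x) : ℝ≥0) ≠ 0 := by positivity
    norm_cast
    field_simp

/-- The transition kernel of the `β`-biased walk on the tree `ω`. -/
noncomputable def stepKernel (β : ℝ≥0) (ω : Tree) : Kernel Vertex Vertex :=
  ⟨step β ω, measurable_from_top⟩

instance instIsMarkovKernelStep (β : ℝ≥0) (ω : Tree) : IsMarkovKernel (stepKernel β ω) :=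
  ⟨fun x => instIsProbabilityMeasureStep β ω x⟩

/-- The transition to time `n + 1` given the trajectory up to time `n`. -/
noncomputable def historyKernel (β : ℝ≥0) (ω : Tree) (n : ℕ) :
    Kernel (Iic n → Vertex) Vertex :=
  (stepKernel β ω).comap (fun h => h ⟨n, mem_Iic.2 le_rfl⟩) (measurable_pi_apply _)

instance instIsMarkovKernelHistory (β : ℝ≥0) (ω : Tree) (n : ℕ) :
    IsMarkovKernel (historyKernel β ω n) := by
  unfold historyKernel; infer_instance

/-- The law `P^ω` of the `β`-biased random walk `(X_n)` on the tree `ω`, started from the root. -/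
noncomputable def quenchedLaw (β : ℝ≥0) (ω : Tree) : Measure (ℕ → Vertex) :=
  Kernel.traj (X := fun _ => Vertex) (historyKernel β ω) 0 fun _ => []

instance instIsProbabilityMeasureQuenched (β : ℝ≥0) (ω : Tree) :
    IsProbabilityMeasure (quenchedLaw β ω) := by
  unfold quenchedLaw; infer_instance

theorem partialTraj_singleton (β : ℝ≥0) (ω : Tree) (n : ℕ) (x : ℕ → Vertex) :
    Kernel.partialTraj (X := fun _ => Vertex) (historyKernel β ω) 0 n (fun _ => [])
      {fun i : Iic n => x i} =
      (if x 0 = [] then 1 else 0) * ∏ i ∈ range n, step β ω (x i) {x (i + 1)} := by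
  induction n with
  | zero =>
    rw [Kernel.partialTraj_self, Kernel.id_apply, Measure.dirac_apply' _ (.singleton _)]
    simp only [Set.indicator, Set.mem_singleton_iff, range_zero, prod_empty, mul_one]
    congr 1
    refine propext ⟨fun h => (congrFun h ⟨0, mem_Iic.2 le_rfl⟩).symm, fun h => ?_⟩
    funext ⟨i, hi⟩
    obtain rfl : i = 0 := by simpa using hi
    exact h.symm
  | succ n ih =>
    have hpre : IicProdIoc (X := fun _ => Vertex) n (n + 1) ⁻¹' {fun i : Iic (n + 1) => x i} =
        {fun i : Iic n => x i} ×ˢ {fun i : Ioc n (n + 1) => x i} := by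
      ext ⟨y, z⟩
      simp only [Set.mem_preimage, Set.mem_singleton_iff, Set.mem_prod]
      constructor
      · intro h
        constructor
        · funext ⟨i, hi⟩
          have := congrFun h ⟨i, by simp at hi ⊢; omega⟩
          simpa [IicProdIoc, mem_Iic.1 hi] using this
        · funext ⟨i, hi⟩
          have := congrFun h ⟨i, by simp at hi ⊢; omega⟩
          have hi' : ¬ i ≤ n := by simp at hi; omega
          simpa [IicProdIoc, hi'] using this
      · rintro ⟨rfl, rfl⟩
        funext ⟨i, hi⟩
        simp [IicProdIoc]
    have hone : (MeasurableEquiv.piSingleton (X := fun _ => Vertex) n) ⁻¹'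
        {fun i : Ioc n (n + 1) => x i} = {x (n + 1)} := by
      ext v
      simp only [Set.mem_preimage, Set.mem_singleton_iff]
      constructor
      · intro h
        have := congrFun h ⟨n + 1, by simp⟩
        simpa [MeasurableEquiv.piSingleton] using this
      · rintro rfl
        funext ⟨i, hi⟩
        obtain rfl : i = n + 1 := by simp at hi; omega
        simp [MeasurableEquiv.piSingleton]
    rw [Kernel.partialTraj_succ_of_le (Nat.zero_le n)]
    refine (Kernel.map_apply' _ (measurable_IicProdIoc (X := fun _ => Vertex)) _
      (.singleton _)).trans ?_
    rw [hpre, Kernel.comp_apply' _ _ _ ((MeasurableSet.singleton _).prod (.singleton _))]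
    have key : ∀ y : Iic n → Vertex,
        (Kernel.id ×ₖ (historyKernel β ω n).map
          (MeasurableEquiv.piSingleton (X := fun _ => Vertex) n)) y
          ({fun i : Iic n => x i} ×ˢ {fun i : Ioc n (n + 1) => x i}) =
        Set.indicator {fun i : Iic n => x i} (fun _ => step β ω (x n) {x (n + 1)}) y := by
      intro y
      rw [Kernel.prod_apply, Measure.prod_prod, Kernel.id_apply, Measure.dirac_apply' _ (.singleton _),
        Kernel.map_apply' _ (MeasurableEquiv.measurable _) _ (.singleton _), hone]
      by_cases hy : y = fun i : Iic n => x i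
      · subst hy; simp [historyKernel, stepKernel, Kernel.comap_apply]
      · simp [hy]
    simp_rw [key]
    rw [lintegral_indicator (.singleton _), setLIntegral_const, ih, prod_range_succ]
    ring

/-- The finite-dimensional distributions of the `β`-biased random walk on `ω`. -/
theorem quenchedLaw_cylinder (β : ℝ≥0) (ω : Tree) (n : ℕ) (x : ℕ → Vertex) :
    quenchedLaw β ω {ξ | ∀ i ≤ n, ξ i = x i} =
      (if x 0 = [] then 1 else 0) * ∏ i ∈ range n, step β ω (x i) {x (i + 1)} := by
  rw [← partialTraj_singleton, ← Kernel.traj_map_frestrictLe_apply,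
    Measure.map_apply (Preorder.measurable_frestrictLe _) (.singleton _)]
  unfold quenchedLaw
  congr 1
  ext ξ
  simp [funext_iff]

theorem measurable_step_apply (β : ℝ≥0) (x : Vertex) (s : Set Vertex) :
    Measurable fun ω : Tree => step β ω x s := by
  have h : ∀ k : ℕ, ∃ c : ℝ≥0∞, ∀ ω : Tree, ω x = k → step β ω x s = c := by
    intro k
    refine ⟨step β (fun _ => k) x s, fun ω hω => ?_⟩
    cases x <;> simp [step, hω]
  choose c hc using h
  have : (fun ω : Tree => step β ω x s) = c ∘ fun ω => ω x := by
    funext ω; exact hc _ ω rfl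
  rw [this]
  exact measurable_from_top.comp (measurable_pi_apply x)

theorem measurable_quenchedLaw (β : ℝ≥0) : Measurable (quenchedLaw β) := by
  refine Measurable.measure_of_isPiSystem_of_isProbabilityMeasure
    generateFrom_measurableCylinders.symm isPiSystem_measurableCylinders fun t ht => ?_
  obtain ⟨N, S, mS, rfl⟩ : ∃ N S, MeasurableSet S ∧ t = cylinder (Iic N) S := by
    simpa [measurableCylinders_nat] using ht
  have h : ∀ ω, quenchedLaw β ω (cylinder (Iic N) S) =
      ∑' y, S.indicator (fun y => quenchedLaw β ω
        {ξ | ∀ i ≤ N, ξ i = if hi : i ≤ N then y ⟨i, mem_Iic.2 hi⟩ else []}) y := by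
    intro ω
    have h1 : quenchedLaw β ω (cylinder (Iic N) S) =
        (quenchedLaw β ω).map (Preorder.frestrictLe (π := fun _ => Vertex) N) S :=
      (Measure.map_apply (Preorder.measurable_frestrictLe _) mS).symm
    rw [h1, ← Measure.tsum_indicator_apply_singleton _ _ mS]
    refine tsum_congr fun y => ?_
    congr 1
    funext y
    rw [Measure.map_apply (Preorder.measurable_frestrictLe _) (.singleton _)]
    congr 1
    ext ξ
    simp only [Set.mem_preimage, Set.mem_singleton_iff, Set.mem_ofPred_eq]
    constructor
    · rintro rfl i hi; simp [hi]
    · intro hξ; funext ⟨i, hi⟩; simpa [mem_Iic.1 hi] using hξ i (mem_Iic.1 hi)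
  simp_rw [h]
  refine Measurable.tsum fun y => ?_
  by_cases hy : y ∈ S
  · simp only [Set.indicator_of_mem hy]
    simp_rw [quenchedLaw_cylinder]
    exact (Finset.measurable_prod _ fun i _ => measurable_step_apply β _ _).const_mul _
  · simp [Set.indicator_of_notMem hy]

/-- The family `ω ↦ P^ω` of the laws of the `β`-biased random walk, as a kernel. -/
noncomputable def quenchedKernel (β : ℝ≥0) : Kernel Tree (ℕ → Vertex) :=
  ⟨quenchedLaw β, measurable_quenchedLaw β⟩

instance instIsMarkovKernelQuenched (β : ℝ≥0) : IsMarkovKernel (quenchedKernel β) :=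
  ⟨fun ω => instIsProbabilityMeasureQuenched β ω⟩

/-- The averaged law of the `β`-biased random walk on the Galton-Watson tree: the semi-direct
product of the law of the tree and of the laws `P^ω`. -/
noncomputable def averagedLaw (p : PMF ℕ) (β : ℝ≥0) : Measure (Tree × (ℕ → Vertex)) :=
  galtonWatson p ⊗ₘ quenchedKernel β

/-- `v` is the speed of the `β`-biased random walk on the Galton-Watson tree with offspring law `p`:
`|X_n| / n` converges to `v` almost surely under the averaged law. -/
def IsSpeed (p : PMF ℕ) (β : ℝ≥0) (v : ℝ) : Prop :=
  ∀ᵐ η ∂averagedLaw p β, Tendsto (fun n : ℕ => ((η.2 n).length : ℝ) / n) atTop (𝓝 v)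

end BiasedWalk

/-! Under the averaged law the tree may be revealed along the walk. One driver of independent
variables supplies, at every time, a uniform variable deciding whether to step back, another
choosing the child, and a number of children to be used if the current vertex is new. Walks with
different biases run on the same driver. All of them are dominated by a walk on `ℤ` (`height`) that
steps back when the first uniform variable is below `q = 1 / (1 + β d)`: its increments never exceed
those of `|X_n|`, because a walk steps back with probability at most `q` whatever the degree. For `β
≥ 717 / d` one has `q ≤ 1 / 718`.

Existence. At a cut time the comparison walk is at a strict record, below which it does not fall up
to the horizon. The true walk then stands at a new vertex and stays in its unexplored subtree, so
later increments are functions of the later driver alone (`explore_add_of_isCut`). Counting cut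
times (`card_isCut_ge`) shows that an interval without one contains many backward steps, which is
exponentially unlikely. So increments are exponentially close to shifted increments: their means
converge, their correlations decay, and a law of large numbers holds (`ae_tendsto_length_div`).

Monotonicity. Take `g' < g ≤ q`, the backward probabilities for `β' > β`, and let `Δ` be the
probability that a uniform variable falls between them at a new vertex. The `β'`-walk gains 2 if
this happens at a record time, which has probability at least `Δ (1 - 4q)`. It loses 2 at time `m`
only if the walks were separated at an earlier time `j`, no cut time has occurred since, and the
comparison walk steps back at `m`. The separation contributes a factor `Δ` and the backward step a
factor `q`; summing over `j` and over the discovery time `i` of the separating vertex costs only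
convergent geometric series. For small `q` the gain wins, by at least `Δ` at every positive time
(`integral_incr_add_le`). As `Δ > 0` does not depend on time, the limits are strictly ordered.

Finally `map_snd_averagedLaw` identifies the law of the exploring walk with that of the biased walk
on the Galton-Watson tree. -/

namespace BiasedWalk

/-! ### The coupling: exploring walks, comparison walk and cut times. -/

/-- The randomness that drives a walk exploring its tree: at time `n` the coordinate `(n, 0)` decides
whether the walk steps back, `(n, 1)` which child it moves to, and `(n, 2)` is the number of children
of the vertex visited at time `n`, if that vertex is new. -/
abbrev Driver : Type := ℕ × Fin 3 → ℝ

/-- The number of children of a new vertex visited at time `n`. -/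
noncomputable def offspring (ω : Driver) (n : ℕ) : ℕ := ⌊ω (n, 2)⌋₊

/-- The driver from time `k` on. -/
def shift (k : ℕ) (ω : Driver) : Driver := fun i => ω (i.1 + k, i.2)

/-- The next position of a walk with probability `g k` to step back from a vertex with `k` children,
as a function of two uniform variables. -/
noncomputable def nextVertex (g : ℕ → ℝ) (x : Vertex) (k : ℕ) (u v : ℝ) : Vertex :=
  if x ≠ [] ∧ u < g k then x.tail else ⌊(k : ℝ) * v⌋₊ :: x

/-- The position of the exploring walk and the numbers of children of the vertices visited so far. -/
noncomputable def explore (g : ℕ → ℝ) (ω : Driver) : ℕ → Vertex × (Vertex → Option ℕ)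
  | 0 => ([], Function.update (fun _ => none) [] (some (offspring ω 0)))
  | n + 1 =>
    let s := explore g ω n
    let y := nextVertex g s.1 ((s.2 s.1).getD 0) (ω (n, 0)) (ω (n, 1))
    (y, Function.update s.2 y (some ((s.2 y).getD (offspring ω (n + 1)))))

/-- The position of the exploring walk. -/
noncomputable def pos (g : ℕ → ℝ) (ω : Driver) (n : ℕ) : Vertex := (explore g ω n).1

/-- The numbers of children of the explored vertices. -/
noncomputable def known (g : ℕ → ℝ) (ω : Driver) (n : ℕ) : Vertex → Option ℕ := (explore g ω n).2

/-- The number of children of the current vertex. -/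
noncomputable def degree (g : ℕ → ℝ) (ω : Driver) (n : ℕ) : ℕ :=
  (known g ω n (pos g ω n)).getD 0

/-- The increment of the distance from the root. -/
noncomputable def incr (g : ℕ → ℝ) (ω : Driver) (n : ℕ) : ℝ :=
  (pos g ω (n + 1)).length - (pos g ω n).length

/-- The indicator of a backward step of the comparison walk on `ℤ`. -/
noncomputable def back (q : ℝ) (ω : Driver) (n : ℕ) : ℕ := if ω (n, 0) < q then 1 else 0

/-- The comparison walk on `ℤ`. -/
noncomputable def height (q : ℝ) (ω : Driver) : ℕ → ℤ
  | 0 => 0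
  | n + 1 => height q ω n + 1 - 2 * back q ω n

/-- The distance of the comparison walk from its running maximum. -/
noncomputable def deficit (q : ℝ) (ω : Driver) : ℕ → ℕ
  | 0 => 0
  | n + 1 => if ω (n, 0) < q then deficit q ω n + 1 else deficit q ω n - 1

/-- The number of backward steps of the comparison walk in a time interval. -/
noncomputable def backs (q : ℝ) (ω : Driver) (a n : ℕ) : ℕ := ∑ t ∈ Ico a n, back q ω t

/-- The comparison walk is at time `k` higher than ever before and stays at least as high up to
time `n`. -/
def IsCut (q : ℝ) (ω : Driver) (k n : ℕ) : Prop :=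
  (∀ j < k, height q ω j < height q ω k) ∧ ∀ j, k ≤ j → j ≤ n → height q ω k ≤ height q ω j

/-! ### Pathwise properties of the exploring walk and of the comparison walk. -/

section Deterministic

variable {g g' : ℕ → ℝ} {q : ℝ} {ω : Driver}

theorem pos_zero : pos g ω 0 = [] := rfl

theorem known_zero (y : Vertex) :
    known g ω 0 y = if y = [] then some (offspring ω 0) else none := by
  simp [known, explore, Function.update_apply]

theorem pos_succ (n : ℕ) :
    pos g ω (n + 1) = nextVertex g (pos g ω n) (degree g ω n) (ω (n, 0)) (ω (n, 1)) := rfl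

theorem known_succ (n : ℕ) (y : Vertex) :
    known g ω (n + 1) y = if y = pos g ω (n + 1) then
      some ((known g ω n y).getD (offspring ω (n + 1))) else known g ω n y := by
  by_cases h : y = pos g ω (n + 1)
  · rw [if_pos h, h]; simp [known, pos, explore]
  · rw [if_neg h]
    exact Function.update_of_ne h _ _

theorem explore_eq (n : ℕ) : explore g ω n = (pos g ω n, known g ω n) := rfl

theorem incr_eq_neg_one {n : ℕ} (h : pos g ω n ≠ []) (hu : ω (n, 0) < g (degree g ω n)) :
    incr g ω n = -1 := by
  rw [incr, pos_succ, nextVertex, if_pos ⟨h, hu⟩]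
  obtain ⟨a, x, hx⟩ := List.exists_cons_of_ne_nil h
  simp [hx]

theorem incr_eq_one {n : ℕ} (h : ¬ (pos g ω n ≠ [] ∧ ω (n, 0) < g (degree g ω n))) :
    incr g ω n = 1 := by
  rw [incr, pos_succ, nextVertex, if_neg h]
  simp

theorem incr_eq (n : ℕ) : incr g ω n = 1 ∨ incr g ω n = -1 := by
  by_cases h : pos g ω n ≠ [] ∧ ω (n, 0) < g (degree g ω n)
  · exact .inr (incr_eq_neg_one h.1 h.2)
  · exact .inl (incr_eq_one h)

theorem height_succ_of_lt {n : ℕ} (h : ω (n, 0) < q) :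
    height q ω (n + 1) = height q ω n - 1 := by
  simp only [height, back, if_pos h]; push_cast; ring

theorem height_succ_of_le {n : ℕ} (h : q ≤ ω (n, 0)) :
    height q ω (n + 1) = height q ω n + 1 := by
  simp [height, back, not_lt.2 h]

/-- A backward step of the exploring walk requires a uniform variable below some `g k ≤ q`, hence is
also a backward step of the comparison walk. Reflection at the root only helps. -/
theorem length_succ_ge (hg : ∀ k, g k ≤ q) (n : ℕ) :
    height q ω (n + 1) - height q ω n ≤ (pos g ω (n + 1)).length - (pos g ω n).length := by
  rw [pos_succ, nextVertex]
  split_ifs with h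
  · rw [height_succ_of_lt (h.2.trans_le (hg _))]
    obtain ⟨a, x, hx⟩ := List.exists_cons_of_ne_nil h.1
    simp [hx]
  · by_cases h' : ω (n, 0) < q
    · rw [height_succ_of_lt h']; simp
    · rw [height_succ_of_le (not_lt.1 h')]; simp

theorem height_sub_le (hg : ∀ k, g k ≤ q) {i j : ℕ} (h : i ≤ j) :
    height q ω j - height q ω i ≤ (pos g ω j).length - (pos g ω i).length := by
  induction j, h using Nat.le_induction with
  | base => simp
  | succ n _ ih => have := length_succ_ge (ω := ω) hg n; omega

/-! ### Counting cut times. -/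

theorem backs_self (a : ℕ) : backs q ω a a = 0 := by simp [backs]

theorem backs_succ {a n : ℕ} (h : a ≤ n) : backs q ω a (n + 1) = backs q ω a n + back q ω n :=
  sum_Ico_succ_top h _

theorem height_sub_eq {i j : ℕ} (h : i ≤ j) :
    height q ω j - height q ω i = (j : ℤ) - i - 2 * backs q ω i j := by
  induction j, h using Nat.le_induction with
  | base => simp [backs_self]
  | succ n hn ih =>
    rw [backs_succ hn, height]; push_cast; linarith

theorem deficit_le {i j : ℕ} (h : i ≤ j) :
    deficit q ω j ≤ deficit q ω i + backs q ω i j := by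
  induction j, h using Nat.le_induction with
  | base => simp
  | succ n hn ih =>
    rw [backs_succ hn, deficit, back]
    split_ifs <;> omega

theorem height_le_add_deficit {j n : ℕ} (h : j ≤ n) :
    height q ω j ≤ height q ω n + deficit q ω n := by
  induction n, h using Nat.le_induction with
  | base => simp
  | succ n _ ih =>
    by_cases h' : ω (n, 0) < q
    · rw [height_succ_of_lt h', deficit, if_pos h']; push_cast; linarith
    · rw [height_succ_of_le (not_lt.1 h'), deficit, if_neg h']; omega

theorem record_of_deficit_eq_zero {n : ℕ} (h0 : deficit q ω n = 0) (hu : q ≤ ω (n, 0)) :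
    ∀ j < n + 1, height q ω j < height q ω (n + 1) := by
  intro j hj
  have := height_le_add_deficit (q := q) (ω := ω) (Nat.lt_succ_iff.1 hj)
  rw [height_succ_of_le hu]
  rw [h0] at this
  push_cast at this
  linarith

open Classical in
/-- The number of cut times grows with every step, up to three for every backward step. -/
theorem card_isCut_ge {a n : ℕ} (h : a ≤ n) :
    (n : ℤ) - a - 3 * backs q ω a n - deficit q ω a + deficit q ω n ≤
      #{k ∈ Icc a n | IsCut q ω k n} := by
  induction n, h using Nat.le_induction with
  | base => simp [backs_self]
  | succ n hn ih =>
    rw [backs_succ hn]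
    by_cases hu : ω (n, 0) < q
    · have h1 : back q ω n = 1 := by simp [back, hu]
      have h2 : deficit q ω (n + 1) = deficit q ω n + 1 := by rw [deficit, if_pos hu]
      -- A backward step destroys only cut times whose height equals the current one. Cut times are
      -- strict records, so at most one is lost. The left side of the bound drops by `1 - 3 + 1 =
      -- -1` accordingly.
      have hc : #{k ∈ Icc a n | IsCut q ω k n} ≤
          #{k ∈ Icc a (n + 1) | IsCut q ω k (n + 1)} + 1 := by
        have hsub : {k ∈ Icc a n | IsCut q ω k n} ⊆ {k ∈ Icc a (n + 1) | IsCut q ω k (n + 1)} ∪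
            {k ∈ Icc a n | IsCut q ω k n ∧ height q ω k = height q ω n} := by
          intro k hk
          simp only [mem_filter, mem_Icc, mem_union] at hk ⊢
          obtain ⟨⟨h3, h4⟩, h5⟩ := hk
          by_cases h6 : height q ω k = height q ω n
          · exact .inr ⟨⟨h3, h4⟩, h5, h6⟩
          · refine .inl ⟨⟨h3, by omega⟩, h5.1, fun j hj hj' => ?_⟩
            rcases Nat.lt_or_ge n j with h7 | h7
            · obtain rfl : j = n + 1 := by omega
              have := h5.2 n h4 le_rfl
              rw [height_succ_of_lt hu]; omega
            · exact h5.2 j hj h7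
        refine (card_le_card hsub).trans ((card_union_le _ _).trans (Nat.add_le_add_left ?_ _))
        refine card_le_one.2 fun k hk l hl => ?_
        simp only [mem_filter, mem_Icc] at hk hl
        rcases lt_trichotomy k l with hkl | hkl | hkl
        · have := hl.2.1.1 k hkl; omega
        · exact hkl
        · have := hk.2.1.1 l hkl; omega
      rw [h1, h2]; push_cast; omega
    · have hu' := not_lt.1 hu
      have h1 : back q ω n = 0 := by simp [back, hu]
      have h2 : deficit q ω (n + 1) = deficit q ω n - 1 := by rw [deficit, if_neg hu]
      have hsub : {k ∈ Icc a n | IsCut q ω k n} ⊆ {k ∈ Icc a (n + 1) | IsCut q ω k (n + 1)} := by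
        intro k hk
        simp only [mem_filter, mem_Icc] at hk ⊢
        obtain ⟨⟨h3, h4⟩, h5⟩ := hk
        refine ⟨⟨h3, by omega⟩, h5.1, fun j hj hj' => ?_⟩
        rcases Nat.lt_or_ge n j with h7 | h7
        · obtain rfl : j = n + 1 := by omega
          have := h5.2 n h4 le_rfl
          rw [height_succ_of_le hu']; omega
        · exact h5.2 j hj h7
      -- A forward step at the running maximum creates the cut time `n + 1`. Below the maximum it
      -- lowers the deficit by one, which offsets the growth of `n`.
      rcases Nat.eq_zero_or_pos (deficit q ω n) with h0 | h0
      · have hnew : IsCut q ω (n + 1) (n + 1) :=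
          ⟨record_of_deficit_eq_zero h0 hu', fun j hj hj' => by rw [le_antisymm hj hj']⟩
        have hss : {k ∈ Icc a n | IsCut q ω k n} ⊂ {k ∈ Icc a (n + 1) | IsCut q ω k (n + 1)} := by
          refine ssubset_iff_of_subset hsub |>.2 ⟨n + 1, ?_, ?_⟩
          · simp only [mem_filter, mem_Icc]
            exact ⟨⟨by omega, le_rfl⟩, hnew⟩
          · simp
        have := card_lt_card hss
        rw [h1, h2]; push_cast; omega
      · have := card_le_card hsub
        rw [h1, h2]; push_cast; omega

theorem le_of_forall_not_isCut {a n : ℕ} (h : a ≤ n)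
    (hc : ∀ k, a ≤ k → k ≤ n → ¬ IsCut q ω k n) : n - a ≤ 3 * backs q ω a n + deficit q ω a := by
  classical
  have h1 := card_isCut_ge (q := q) (ω := ω) h
  rw [filter_eq_empty_iff.2 fun k hk => hc k (mem_Icc.1 hk).1 (mem_Icc.1 hk).2, card_empty] at h1
  omega

/-! ### Regeneration at cut times. -/

theorem shift_zero : shift 0 ω = ω := rfl

theorem shift_shift (a k : ℕ) : shift k (shift a ω) = shift (k + a) ω := by
  funext i; simp [shift, add_assoc]

theorem offspring_shift (k n : ℕ) : offspring (shift k ω) n = offspring ω (n + k) := rfl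

theorem height_shift (a t : ℕ) : height q (shift a ω) t = height q ω (t + a) - height q ω a := by
  induction t with
  | zero => simp [height]
  | succ t ih =>
    rw [height, ih, show t + 1 + a = t + a + 1 by omega, height]
    have hb : back q (shift a ω) t = back q ω (t + a) := rfl
    rw [hb]; ring

/-- Dropping the driver before `a` leaves fewer earlier heights to exceed. -/
theorem IsCut.shift {a k n : ℕ} (hak : a ≤ k) (hkn : k ≤ n) (h : IsCut q ω k n) :
    IsCut q (shift a ω) (k - a) (n - a) := by
  refine ⟨fun j hj => ?_, fun j hj hj' => ?_⟩
  · rw [height_shift, height_shift, Nat.sub_add_cancel hak]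
    have := h.1 (j + a) (by omega); omega
  · rw [height_shift, height_shift, Nat.sub_add_cancel hak]
    have := h.2 (j + a) (by omega) (by omega); omega

theorem exists_of_known {n : ℕ} {y : Vertex} {m : ℕ} (h : known g ω n y = some m) :
    ∃ i ≤ n, pos g ω i = y ∧ m = offspring ω i := by
  induction n with
  | zero =>
    rw [known_zero] at h
    split_ifs at h with hy
    exact ⟨0, le_rfl, hy.symm, (Option.some.inj h).symm⟩
  | succ n ih =>
    rw [known_succ] at h
    split_ifs at h with hy
    · rcases hk : known g ω n y with _ | m'
      · rw [hk] at h
        exact ⟨n + 1, le_rfl, hy.symm, (Option.some.inj h).symm⟩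
      · rw [hk] at h
        obtain rfl : m' = m := Option.some.inj h
        obtain ⟨i, hi, h'⟩ := ih hk
        exact ⟨i, by omega, h'⟩
    · obtain ⟨i, hi, h'⟩ := ih h
      exact ⟨i, by omega, h'⟩

/-- Hence the default value `0` in `explore` and `degree` is never used. -/
theorem known_pos (n : ℕ) : known g ω n (pos g ω n) = some (degree g ω n) := by
  cases n with
  | zero => rw [degree, pos_zero, known_zero]; rfl
  | succ n => rw [degree, known_succ, if_pos rfl]; rfl

theorem exists_degree (g : ℕ → ℝ) (ω : Driver) (n : ℕ) :
    ∃ i ≤ n, pos g ω i = pos g ω n ∧ degree g ω n = offspring ω i :=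
  exists_of_known (known_pos n)

theorem length_lt_of_record (hg : ∀ k, g k ≤ q) {k : ℕ}
    (h : ∀ j < k, height q ω j < height q ω k) {j : ℕ} (hj : j < k) :
    (pos g ω j).length < (pos g ω k).length := by
  have := height_sub_le (ω := ω) hg hj.le
  have := h j hj
  omega

/-- Vertices visited before a record are strictly shorter than the current one, while its
descendants are at least as long: the whole subtree is unexplored except for its root. -/
theorem known_of_record (hg : ∀ k, g k ≤ q) {k : ℕ}
    (h : ∀ j < k, height q ω j < height q ω k) (y : Vertex) :
    known g ω k (y ++ pos g ω k) = if y = [] then some (offspring ω k) else none := by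
  have hnone : ∀ y, ∀ j < k, known g ω j (y ++ pos g ω k) = none := by
    intro y j hj
    rcases hk : known g ω j (y ++ pos g ω k) with _ | m
    · rfl
    · obtain ⟨i, hi, hp, -⟩ := exists_of_known hk
      have := length_lt_of_record hg h (show i < k by omega)
      rw [hp, List.length_append] at this
      omega
  cases k with
  | zero => simp [pos_zero, known_zero]
  | succ k =>
    rw [known_succ, hnone y k (by omega)]
    simp

theorem degree_of_record (hg : ∀ k, g k ≤ q) {k : ℕ}
    (h : ∀ j < k, height q ω j < height q ω k) : degree g ω k = offspring ω k := by
  have := known_of_record hg h []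
  rw [List.nil_append, known_pos, if_pos rfl] at this
  exact Option.some.inj this

/-- After a cut time the walk depends on the past by a translation only. -/
theorem explore_add_of_isCut (hg : ∀ k, g k ≤ q) {k n : ℕ} (h : IsCut q ω k n) (t : ℕ)
    (ht : t + k ≤ n) : pos g ω (t + k) = pos g (shift k ω) t ++ pos g ω k ∧
      ∀ y, known g ω (t + k) (y ++ pos g ω k) = known g (shift k ω) t y := by
  induction t with
  | zero =>
    refine ⟨by simp [pos_zero], fun y => ?_⟩
    rw [Nat.zero_add, known_of_record hg h.1, known_zero, offspring_shift, Nat.zero_add]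
  | succ t ih =>
    obtain ⟨ih1, ih2⟩ := ih (by omega)
    have hdeg : degree g ω (t + k) = degree g (shift k ω) t := by
      rw [degree, ih1, ih2]; rfl
    have hpos : pos g ω (t + 1 + k) = pos g (shift k ω) (t + 1) ++ pos g ω k := by
      rw [show t + 1 + k = t + k + 1 by omega, pos_succ, pos_succ, hdeg, ih1]
      have e0 : shift k ω (t, 0) = ω (t + k, 0) := rfl
      have e1 : shift k ω (t, 1) = ω (t + k, 1) := rfl
      rw [e0, e1]
      rcases hp : pos g (shift k ω) t with _ | ⟨a, x⟩
      -- The shifted walk is reflected at its root, where the original walk could leave the subtree.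
      -- It does not: a backward step there would take the comparison walk below its height at the
      -- cut time.
      · by_cases hu : ω (t + k, 0) < g (degree g (shift k ω) t)
        · exfalso
          have h1 := height_succ_of_lt (hu.trans_le (hg _))
          have h2 := h.2 (t + k + 1) (by omega) (by omega)
          have h3 := height_sub_le (ω := ω) hg (Nat.le_add_left k t)
          rw [ih1, hp] at h3
          simp at h3
          omega
        · simp [nextVertex, hu]
      · by_cases hu : ω (t + k, 0) < g (degree g (shift k ω) t) <;> simp [nextVertex, hu]
    refine ⟨hpos, fun y => ?_⟩
    have e : known g ω (t + 1 + k) (y ++ pos g ω k) = if y ++ pos g ω k = pos g ω (t + 1 + k) then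
      some ((known g ω (t + k) (y ++ pos g ω k)).getD (offspring ω (t + 1 + k)))
      else known g ω (t + k) (y ++ pos g ω k) := by
      rw [show t + 1 + k = t + k + 1 by omega]; exact known_succ _ _
    rw [e, known_succ, ih2, hpos]
    simp only [List.append_cancel_right_eq, offspring_shift]

/-- The horizon is `n + 1` because the increment involves both positions, at `n` and at `n + 1`. -/
theorem incr_of_isCut (hg : ∀ k, g k ≤ q) {k n : ℕ} (h : IsCut q ω k (n + 1)) (hk : k ≤ n) :
    incr g ω n = incr g (shift k ω) (n - k) := by
  have h1 := (explore_add_of_isCut hg h (n - k) (by omega)).1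
  have h2 := (explore_add_of_isCut hg h (n - k + 1) (by omega)).1
  rw [show n - k + k = n by omega] at h1
  rw [show n - k + 1 + k = n + 1 by omega] at h2
  rw [incr, incr, h1, h2]
  simp

theorem incr_of_record (hg : ∀ k, g k ≤ q) {n : ℕ}
    (h : ∀ j < n + 1, height q ω j < height q ω (n + 1)) : incr g ω n = 1 := by
  refine incr_eq_one fun h' => ?_
  have := height_succ_of_lt (h'.2.trans_le (hg _))
  have := h n (by omega)
  omega

/-- If there is a cut time after time `a`, then the walk has forgotten everything before `a`. -/
theorem incr_eq_incr_shift (hg : ∀ k, g k ≤ q) {a k n : ℕ} (hak : a ≤ k) (han : a ≤ n)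
    (hk : k ≤ n + 1) (h : IsCut q ω k (n + 1)) : incr g ω n = incr g (shift a ω) (n - a) := by
  have h' := h.shift hak hk
  rw [show n + 1 - a = n - a + 1 by omega] at h'
  -- If the cut time is `n + 1` itself, regeneration says nothing about step `n`, but a record at `n
  -- + 1` forces this step to be forward for both drivers.
  rcases Nat.lt_or_ge n k with h1 | h1
  · obtain rfl : k = n + 1 := by omega
    rw [incr_of_record hg h.1]
    rw [show n + 1 - a = n - a + 1 by omega] at h'
    rw [incr_of_record hg h'.1]
  · rw [incr_of_isCut hg h h1, incr_of_isCut hg h' (by omega), shift_shift,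
      show k - a + a = k by omega, show n - a - (k - a) = n - k by omega]

/-! ### Pathwise comparison of two walks on the same driver. -/

/-- The walk with the larger probabilities to step back falls behind at a time at which the
comparison walk is higher than ever before, if the driver lies between the two probabilities. -/
theorem incr_sub_incr_of_record (hg : ∀ k, g k ≤ q) (hg' : ∀ k, g' k ≤ q) {m : ℕ} (hm : 1 ≤ m)
    (h : ∀ j < m, height q ω j < height q ω m) (h1 : g' (offspring ω m) ≤ ω (m, 0))
    (h2 : ω (m, 0) < g (offspring ω m)) : incr g' ω m - incr g ω m = 2 := by
  have hne : pos g ω m ≠ [] := by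
    intro h0
    have := length_lt_of_record hg h (show 0 < m by omega)
    simp [h0] at this
  rw [incr_eq_neg_one hne (by rwa [degree_of_record hg h]), incr_eq_one]
  · norm_num
  · rw [degree_of_record hg' h]
    exact fun h' => absurd h'.2 (not_lt.2 h1)

/-- Without an earlier discrepancy both explorations are in the same state at time `n`, and from a
common state the walk with the smaller backward probabilities cannot do worse. This is why `j < n`
is strict. -/
theorem exists_discrepancy (hgg : ∀ k, g' k ≤ g k) {n : ℕ} (h : incr g' ω n < incr g ω n) :
    ∃ j < n, g' (degree g ω j) ≤ ω (j, 0) ∧ ω (j, 0) < g (degree g ω j) := by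
  by_contra! hno
  have key : ∀ t ≤ n, explore g' ω t = explore g ω t := by
    intro t ht
    induction t with
    | zero => rfl
    | succ t ih =>
      have ih := ih (by omega)
      have hpos : pos g' ω t = pos g ω t := congrArg Prod.fst ih
      have hkn : known g' ω t = known g ω t := congrArg Prod.snd ih
      have hdeg : degree g' ω t = degree g ω t := by rw [degree, hpos, hkn]; rfl
      have hp : pos g' ω (t + 1) = pos g ω (t + 1) := by
        rw [pos_succ, pos_succ, hdeg, hpos]
        have : ω (t, 0) < g' (degree g ω t) ↔ ω (t, 0) < g (degree g ω t) :=
          ⟨fun h => h.trans_le (hgg _), fun h => by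
            by_contra h'
            exact absurd h (not_lt.2 (hno t (by omega) (not_lt.1 h')))⟩
        simp only [nextVertex, this]
      rw [explore_eq, explore_eq, hp]
      congr 1
      funext y
      rw [known_succ, known_succ, hp, hkn]
  have e := key n le_rfl
  have hpos : pos g' ω n = pos g ω n := congrArg Prod.fst e
  have hdeg : degree g' ω n = degree g ω n := by
    rw [degree, hpos, show known g' ω n = known g ω n from congrArg Prod.snd e]; rfl
  by_cases h' : pos g' ω n ≠ [] ∧ ω (n, 0) < g' (degree g' ω n)
  · have : incr g ω n = -1 := by
      refine incr_eq_neg_one (hpos ▸ h'.1) ?_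
      rw [← hdeg]; exact h'.2.trans_le (hgg _)
    rcases incr_eq (g := g') (ω := ω) n with h1 | h1 <;> rw [h1, this] at h <;> norm_num at h
  · rw [incr_eq_one h'] at h
    rcases incr_eq (g := g) (ω := ω) n with h1 | h1 <;> rw [h1] at h <;> norm_num at h

/-- If the walk with the smaller probabilities to step back loses ground at time `m`, then the two
walks have been separated at some time `j`, and no cut time has occurred since. -/
theorem exists_of_incr_lt (hg : ∀ k, g k ≤ q) (hgg : ∀ k, g' k ≤ g k) {m : ℕ}
    (h : incr g' ω m < incr g ω m) :
    ω (m, 0) < q ∧ ∃ j < m, ∃ i ≤ j, height q ω j ≤ height q ω i ∧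
      g' (offspring ω i) ≤ ω (j, 0) ∧ ω (j, 0) < g (offspring ω i) ∧
      ∀ k, j + 1 ≤ k → k ≤ m + 1 → ¬ IsCut q ω k (m + 1) := by
  classical
  have hg' : ∀ k, g' k ≤ q := fun k => (hgg k).trans (hg k)
  have hum : ω (m, 0) < q := by
    by_contra hu
    have : incr g' ω m = 1 := incr_eq_one fun h' => hu (h'.2.trans_le (hg' _))
    rcases incr_eq (g := g) (ω := ω) m with h1 | h1 <;> rw [h1, this] at h <;> norm_num at h
  refine ⟨hum, ?_⟩
  -- Restart both walks at the last cut time `k ≤ m`, or at `0` if there is none. The time `m + 1`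
  -- is no cut time since step `m` is backward, so no cut time follows `k`, and the discrepancy must
  -- occur at or after `k`.
  obtain ⟨k, hkm, hinc, hcut⟩ : ∃ k ≤ m, (incr g' (shift k ω) (m - k) < incr g (shift k ω) (m - k)) ∧
      ∀ l, k + 1 ≤ l → l ≤ m + 1 → ¬ IsCut q ω l (m + 1) := by
    by_cases hex : ∃ k, k ≤ m ∧ IsCut q ω k (m + 1)
    · obtain ⟨k0, hk0, hc0⟩ := hex
      set k := Nat.findGreatest (fun k => IsCut q ω k (m + 1)) m with hk
      have hc : IsCut q ω k (m + 1) := Nat.findGreatest_spec (P := fun k => IsCut q ω k (m + 1)) hk0 hc0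
      have hkm : k ≤ m := Nat.findGreatest_le m
      refine ⟨k, hkm, ?_, fun l hl hl' hcl => ?_⟩
      · rwa [← incr_of_isCut hg hc hkm, ← incr_of_isCut hg' hc hkm]
      · rcases Nat.lt_or_ge m l with h1 | h1
        · obtain rfl : l = m + 1 := by omega
          have := hcl.1 m (by omega)
          rw [height_succ_of_lt hum] at this
          omega
        · exact Nat.findGreatest_is_greatest (P := fun k => IsCut q ω k (m + 1)) (by omega) h1 hcl
    · push Not at hex
      refine ⟨0, by omega, by simpa [shift_zero] using h, fun l hl hl' hcl => ?_⟩
      rcases Nat.lt_or_ge m l with h1 | h1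
      · obtain rfl : l = m + 1 := by omega
        have := hcl.1 m (by omega)
        rw [height_succ_of_lt hum] at this
        omega
      · exact hex l h1 hcl
  obtain ⟨t, ht, h1, h2⟩ := exists_discrepancy hgg hinc
  obtain ⟨s, hs, hps, hds⟩ := exists_degree g (shift k ω) t
  rw [hds, offspring_shift] at h1 h2
  refine ⟨t + k, by omega, s + k, by omega, ?_, h1, h2, fun l hl => hcut l (by omega)⟩
  -- The walk is at the same vertex at the times `s` and `t`, so the dominated comparison walk has
  -- not risen in between.
  have h3 := height_sub_le (ω := shift k ω) hg hs
  rw [hps, height_shift, height_shift] at h3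
  omega

end Deterministic

/-! ### The law of the driver and independence of disjoint sets of coordinates. -/

/-- The uniform distribution on `[0, 1)`. -/
noncomputable def uniformLaw : Measure ℝ := volume.restrict (Set.Ico 0 1)

instance instIsProbabilityMeasureUniformLaw : IsProbabilityMeasure uniformLaw :=
  ⟨by simp [uniformLaw]⟩

/-- The law of the coordinates of the driver. -/
noncomputable def coordLaw (p : PMF ℕ) (c : Fin 3) : Measure ℝ :=
  if c = 2 then p.toMeasure.map (fun k : ℕ => (k : ℝ)) else uniformLaw

instance instIsProbabilityMeasureCoordLaw (p : PMF ℕ) (c : Fin 3) :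
    IsProbabilityMeasure (coordLaw p c) := by
  unfold coordLaw
  split_ifs
  · exact Measure.isProbabilityMeasure_map measurable_from_top.aemeasurable
  · infer_instance

/-- The law of the driver: all coordinates are independent. -/
noncomputable def driverLaw (p : PMF ℕ) : Measure Driver :=
  Measure.infinitePi fun i : ℕ × Fin 3 => coordLaw p i.2

instance instIsProbabilityMeasureDriverLaw (p : PMF ℕ) : IsProbabilityMeasure (driverLaw p) := by
  unfold driverLaw; infer_instance

theorem uniformLaw_Iio {c : ℝ} (h1 : c ≤ 1) : uniformLaw (Set.Iio c) = ENNReal.ofReal c := by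
  rw [uniformLaw, Measure.restrict_apply measurableSet_Iio, Set.inter_comm, Set.Ico_inter_Iio,
    min_eq_right h1, Real.volume_Ico, sub_zero]

theorem uniformLaw_Ico {a c : ℝ} (h0 : 0 ≤ a) (h1 : c ≤ 1) :
    uniformLaw (Set.Ico a c) = ENNReal.ofReal (c - a) := by
  rw [uniformLaw, Measure.restrict_apply measurableSet_Ico, Set.Ico_inter_Ico,
    sup_eq_left.2 h0, inf_eq_left.2 h1, Real.volume_Ico]

theorem measurable_offspring (n : ℕ) : Measurable fun ω : Driver => offspring ω n :=
  Nat.measurable_floor.comp (measurable_pi_apply _)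

theorem measurable_shift (k : ℕ) : Measurable (shift k) :=
  measurable_pi_lambda _ fun _ => measurable_pi_apply _

theorem map_shift_driverLaw (p : PMF ℕ) (k : ℕ) : (driverLaw p).map (shift k) = driverLaw p := by
  have h : Function.Injective fun i : ℕ × Fin 3 => (i.1 + k, i.2) := by
    rintro ⟨a, b⟩ ⟨c, d⟩ h
    simpa using h
  exact Measure.map_infinitePi_infinitePi_of_inj (P := fun i : ℕ × Fin 3 => coordLaw p i.2) h

theorem comap_le_of_dependsOn {γ : Type*} [MeasurableSpace γ] {f : Driver → γ} (hf : Measurable f)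
    {S : Set (ℕ × Fin 3)} (hS : DependsOn f S) : MeasurableSpace.comap f inferInstance ≤
      ⨆ i ∈ S, MeasurableSpace.comap (fun ω : Driver => ω i) inferInstance := by
  classical
  -- Setting the coordinates outside `S` to zero does not change `f`, and this map is measurable for
  -- the σ-algebra generated by the coordinates in `S`.
  set e : Driver → Driver := fun ω i => if i ∈ S then ω i else 0
  have hfe : f = f ∘ e := by
    funext ω
    exact hS fun i hi => by simp [e, hi]
  have he : Measurable[⨆ i ∈ S, MeasurableSpace.comap (fun ω : Driver => ω i) inferInstance] e := by
    refine @measurable_pi_lambda _ _ _ (_) _ _ fun i => ?_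
    by_cases hi : i ∈ S
    · simp only [e, hi, if_true]
      exact Measurable.mono (comap_measurable fun ω : Driver => ω i)
        (le_iSup₂ (f := fun i (_ : i ∈ S) =>
          MeasurableSpace.comap (fun ω : Driver => ω i) inferInstance) i hi) le_rfl
    · simp only [e, hi, if_false]
      exact @measurable_const _ _ _ (_) _
  rw [hfe]
  exact (hf.comp he).comap_le

/-- Functions of disjoint sets of coordinates are independent. -/
theorem indepFun_of_dependsOn (p : PMF ℕ) {α β : Type*} [MeasurableSpace α] [MeasurableSpace β]
    {f : Driver → α} {h : Driver → β} (hf : Measurable f) (hh : Measurable h)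
    {S T : Set (ℕ × Fin 3)} (hfS : DependsOn f S) (hhT : DependsOn h T) (hST : Disjoint S T) :
    IndepFun f h (driverLaw p) := by
  rw [IndepFun_iff_Indep]
  have hind : iIndepFun (fun (i : ℕ × Fin 3) (ω : Driver) => ω i) (driverLaw p) :=
    iIndepFun_infinitePi (P := fun i : ℕ × Fin 3 => coordLaw p i.2) (X := fun _ x => x)
      fun _ => measurable_id
  exact indep_of_indep_of_le_left (indep_of_indep_of_le_right
    (indep_iSup_of_disjoint (fun i => (measurable_pi_apply i).comap_le) hind.iIndep hST)
    (comap_le_of_dependsOn hh hhT)) (comap_le_of_dependsOn hf hfS)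

theorem integral_mul_of_dependsOn (p : PMF ℕ) {f h : Driver → ℝ} (hf : Measurable f)
    (hh : Measurable h) {S T : Set (ℕ × Fin 3)} (hfS : DependsOn f S) (hhT : DependsOn h T)
    (hST : Disjoint S T) :
    ∫ ω, f ω * h ω ∂driverLaw p = (∫ ω, f ω ∂driverLaw p) * ∫ ω, h ω ∂driverLaw p :=
  (indepFun_of_dependsOn p hf hh hfS hhT hST).integral_fun_mul_eq_mul_integral
    hf.aestronglyMeasurable hh.aestronglyMeasurable

theorem dependsOn_comp_shift {α : Type*} (f : Driver → α) (k : ℕ) :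
    DependsOn (fun ω => f (shift k ω)) {i | k ≤ i.1} := by
  intro ω ω' h
  have : shift k ω = shift k ω' := funext fun i => h _ (by simp)
  simp only [this]

/-! ### Measurability -/

section Measurability

variable {g g' : ℕ → ℝ} {q : ℝ}

theorem measurable_nextVertex (x : Vertex) (k n : ℕ) :
    Measurable fun ω : Driver => nextVertex g x k (ω (n, 0)) (ω (n, 1)) := by
  refine Measurable.ite ?_ measurable_const ?_
  · exact (MeasurableSet.const _).inter (measurableSet_lt (measurable_pi_apply _) measurable_const)
  · exact (measurable_from_top (f := fun i : ℕ => i :: x)).comp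
      (Nat.measurable_floor.comp ((measurable_pi_apply _).const_mul _))

/-- The two claims are proved together because each step reads the number of children at the current
position. All values involved are countable, so events split into countable unions over them. -/
theorem measurableSet_explore (n : ℕ) :
    (∀ x, MeasurableSet {ω | pos g ω n = x}) ∧
      ∀ y o, MeasurableSet {ω | known g ω n y = o} := by
  induction n with
  | zero =>
    refine ⟨fun x => by simp only [pos_zero]; exact .const _, fun y o => ?_⟩
    simp only [known_zero]
    by_cases hy : y = []
    · simp only [hy, if_true]
      cases o with
      | none => simp
      | some k =>
        simp only [Option.some.injEq]
        exact measurable_offspring 0 (.singleton k)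
    · simp only [hy, if_false]; exact .const _
  | succ n ih =>
    have hpos : ∀ x, MeasurableSet {ω | pos g ω (n + 1) = x} := by
      intro x
      have : {ω | pos g ω (n + 1) = x} = ⋃ (y : Vertex) (k : ℕ), {ω | pos g ω n = y} ∩
          ({ω | known g ω n y = some k} ∩
            {ω | nextVertex g y k (ω (n, 0)) (ω (n, 1)) = x}) := by
        ext ω
        simp only [Set.mem_ofPred_eq, Set.mem_iUnion, Set.mem_inter_iff]
        constructor
        · intro h
          exact ⟨_, _, rfl, known_pos n, h⟩
        · rintro ⟨y, k, rfl, h1, h2⟩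
          rw [pos_succ, degree, h1]; exact h2
      rw [this]
      refine .iUnion fun y => .iUnion fun k => (ih.1 y).inter ((ih.2 _ _).inter ?_)
      exact measurable_nextVertex y k n (.singleton x)
    refine ⟨hpos, fun y o => ?_⟩
    have : {ω | known g ω (n + 1) y = o} = ({ω | pos g ω (n + 1) = y} ∩
        ⋃ (o' : Option ℕ) (k : ℕ), {ω | known g ω n y = o'} ∩ ({ω | offspring ω (n + 1) = k} ∩
          {_ω | some (o'.getD k) = o})) ∪
        ({ω | pos g ω (n + 1) = y}ᶜ ∩ {ω | known g ω n y = o}) := by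
      ext ω
      simp only [Set.mem_ofPred_eq, Set.mem_iUnion, Set.mem_inter_iff, Set.mem_union,
        Set.mem_compl_iff, known_succ, eq_comm (a := y)]
      by_cases h : pos g ω (n + 1) = y <;> simp [h]
    rw [this]
    refine ((hpos y).inter (.iUnion fun o' => .iUnion fun k => (ih.2 _ _).inter
      (.inter ?_ (.const _)))).union ((hpos y).compl.inter (ih.2 _ _))
    exact measurable_offspring _ (.singleton k)

theorem measurable_pos (n : ℕ) : Measurable fun ω => pos g ω n :=
  measurable_to_countable' fun x => (measurableSet_explore n).1 x

theorem measurable_incr (n : ℕ) : Measurable fun ω => incr g ω n :=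
  ((measurable_from_top (f := fun x : Vertex => (x.length : ℝ))).comp (measurable_pos _)).sub
    ((measurable_from_top (f := fun x : Vertex => (x.length : ℝ))).comp (measurable_pos _))

theorem measurable_back (n : ℕ) : Measurable fun ω => back q ω n :=
  Measurable.ite (measurableSet_lt (measurable_pi_apply _) measurable_const)
    measurable_const measurable_const

theorem measurable_backs (a n : ℕ) : Measurable fun ω => backs q ω a n :=
  Finset.measurable_sum _ fun _ _ => measurable_back _

theorem measurable_deficit (n : ℕ) : Measurable fun ω => deficit q ω n := by
  induction n with
  | zero => exact measurable_const
  | succ n ih =>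
    exact Measurable.ite (measurableSet_lt (measurable_pi_apply _) measurable_const)
      ((measurable_from_top (f := fun k : ℕ => k + 1)).comp ih)
      ((measurable_from_top (f := fun k : ℕ => k - 1)).comp ih)

theorem measurable_height (n : ℕ) : Measurable fun ω => height q ω n := by
  induction n with
  | zero => exact measurable_const
  | succ n ih =>
    exact (ih.add measurable_const).sub (((measurable_from_top (f := fun k : ℕ => (k : ℤ))).comp
      (measurable_back n)).const_mul _)

theorem measurableSet_isCut (k n : ℕ) : MeasurableSet {ω | IsCut q ω k n} := by
  unfold IsCut
  simp only [Set.ofPred_and, Set.ofPred_forall]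
  refine .inter (.iInter fun j => .iInter fun _ => ?_)
    (.iInter fun j => .iInter fun _ => .iInter fun _ => ?_)
  · exact measurableSet_lt (measurable_height _) (measurable_height _)
  · exact measurableSet_le (measurable_height _) (measurable_height _)

/-! ### Dependence on the coordinates -/

theorem dependsOn_explore (n : ℕ) :
    DependsOn (fun ω => explore g ω n) {i | i.1 < n ∨ i = (n, 2)} := by
  induction n with
  | zero =>
    intro ω ω' h
    have : offspring ω 0 = offspring ω' 0 := by simp only [offspring, h (0, 2) (by simp)]
    simp only [explore, this]
  | succ n ih =>
    intro ω ω' h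
    have h1 : explore g ω n = explore g ω' n := ih fun i hi => h i (by
      rcases hi with hi | rfl
      · exact .inl (by omega)
      · exact .inl (by simp))
    have h2 : offspring ω (n + 1) = offspring ω' (n + 1) := by
      simp only [offspring, h (n + 1, 2) (by simp)]
    simp only [explore, h1, h2, h (n, 0) (by simp), h (n, 1) (by simp)]

/-- The offspring variable of time `n` enters the explored tree but not the position. Hence the
increment at time `n` uses coordinates up to time `n` only and is independent of the driver from `n
+ 1` on. -/
theorem dependsOn_pos (n : ℕ) : DependsOn (fun ω => pos g ω n) {i | i.1 < n} := by
  cases n with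
  | zero => intro ω ω' _; rfl
  | succ n =>
    intro ω ω' h
    have h1 : explore g ω n = explore g ω' n := dependsOn_explore n fun i hi => h i (by
      rcases hi with hi | rfl
      · exact Nat.lt_succ_of_lt hi
      · simp)
    simp only [pos, explore, h1, h (n, 0) (by simp), h (n, 1) (by simp)]

theorem dependsOn_incr (n : ℕ) : DependsOn (fun ω => incr g ω n) {i | i.1 ≤ n} := by
  intro ω ω' h
  have h1 : pos g ω (n + 1) = pos g ω' (n + 1) :=
    dependsOn_pos (n + 1) fun i hi => h i (Nat.lt_succ_iff.1 hi)
  have h2 : pos g ω n = pos g ω' n := dependsOn_pos n fun i hi => h i (Nat.le_of_lt hi)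
  simp only [incr, h1, h2]

theorem dependsOn_back (n : ℕ) : DependsOn (fun ω => back q ω n) {(n, 0)} := by
  intro ω ω' h
  simp only [back, h (n, 0) rfl]

theorem dependsOn_backs (a n : ℕ) :
    DependsOn (fun ω => backs q ω a n) {i | i.2 = 0 ∧ a ≤ i.1 ∧ i.1 < n} := by
  intro ω ω' h
  refine sum_congr rfl fun t ht => ?_
  rw [mem_Ico] at ht
  exact dependsOn_back t fun i hi => h i (by
    rw [Set.mem_singleton_iff] at hi
    subst hi; exact ⟨rfl, ht.1, ht.2⟩)

theorem dependsOn_deficit (n : ℕ) :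
    DependsOn (fun ω => deficit q ω n) {i | i.2 = 0 ∧ i.1 < n} := by
  induction n with
  | zero => intro ω ω' _; rfl
  | succ n ih =>
    intro ω ω' h
    have h1 : deficit q ω n = deficit q ω' n := ih fun i hi => h i ⟨hi.1, Nat.lt_succ_of_lt hi.2⟩
    simp only [deficit, h1, h (n, 0) (by simp)]

end Measurability

/-! ### Exponential moments -/

/-- Measurable and bounded functions of the driver. -/
def BoundedMeasurable (f : Driver → ℝ) : Prop := Measurable f ∧ ∃ C, ∀ ω, |f ω| ≤ C

theorem BoundedMeasurable.integrable {f : Driver → ℝ} (h : BoundedMeasurable f) (p : PMF ℕ) :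
    Integrable f (driverLaw p) := by
  obtain ⟨C, hC⟩ := h.2
  exact .of_bound h.1.aestronglyMeasurable C (.of_forall hC)

theorem BoundedMeasurable.mul {f h : Driver → ℝ} (hf : BoundedMeasurable f)
    (hh : BoundedMeasurable h) : BoundedMeasurable fun ω => f ω * h ω := by
  obtain ⟨C, hC⟩ := hf.2
  obtain ⟨D, hD⟩ := hh.2
  exact ⟨hf.1.mul hh.1, C * D, fun ω => by
    rw [abs_mul]
    exact mul_le_mul (hC ω) (hD ω) (abs_nonneg _) ((abs_nonneg _).trans (hC ω))⟩

theorem BoundedMeasurable.add {f h : Driver → ℝ} (hf : BoundedMeasurable f)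
    (hh : BoundedMeasurable h) : BoundedMeasurable fun ω => f ω + h ω := by
  obtain ⟨C, hC⟩ := hf.2
  obtain ⟨D, hD⟩ := hh.2
  exact ⟨hf.1.add hh.1, C + D, fun ω => (abs_add_le _ _).trans (add_le_add (hC ω) (hD ω))⟩

theorem boundedMeasurable_const (c : ℝ) : BoundedMeasurable fun _ => c :=
  ⟨measurable_const, |c|, fun _ => le_rfl⟩

theorem BoundedMeasurable.sub {f h : Driver → ℝ} (hf : BoundedMeasurable f)
    (hh : BoundedMeasurable h) : BoundedMeasurable fun ω => f ω - h ω := by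
  have := hf.add ((boundedMeasurable_const (-1)).mul hh)
  simpa [sub_eq_add_neg] using this

theorem BoundedMeasurable.sum {ι : Type*} (s : Finset ι) {f : ι → Driver → ℝ}
    (h : ∀ i ∈ s, BoundedMeasurable (f i)) : BoundedMeasurable fun ω => ∑ i ∈ s, f i ω := by
  classical
  induction s using Finset.induction_on with
  | empty => simpa using boundedMeasurable_const 0
  | insert a s ha ih =>
    simp only [sum_insert ha]
    exact (h a (mem_insert_self _ _)).add (ih fun i hi => h i (mem_insert_of_mem hi))

theorem boundedMeasurable_pow {f : Driver → ℕ} (hf : Measurable f) {N : ℕ} (hN : ∀ ω, f ω ≤ N)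
    {c : ℝ} (hc : 1 ≤ c) : BoundedMeasurable fun ω => c ^ f ω :=
  ⟨(measurable_from_top (f := fun k : ℕ => c ^ k)).comp hf, c ^ N, fun ω => by
    rw [abs_of_nonneg (by positivity)]
    exact pow_le_pow_right₀ hc (hN ω)⟩

section Moments

variable {q : ℝ} (p : PMF ℕ)

theorem back_le_one (ω : Driver) (n : ℕ) : back q ω n ≤ 1 := by
  unfold back; split_ifs <;> simp

theorem backs_le (ω : Driver) (a n : ℕ) : backs q ω a n ≤ n := by
  refine (sum_le_card_nsmul _ _ 1 fun t _ => back_le_one ω t).trans ?_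
  simp

theorem deficit_le_self (ω : Driver) (n : ℕ) : deficit q ω n ≤ n := by
  have := deficit_le (q := q) (ω := ω) (Nat.zero_le n)
  rw [deficit, zero_add] at this
  exact this.trans (backs_le ω 0 n)

theorem boundedMeasurable_two_pow_deficit (n : ℕ) :
    BoundedMeasurable fun ω => (2 : ℝ) ^ deficit q ω n :=
  boundedMeasurable_pow (measurable_deficit n) (fun ω => deficit_le_self ω n) (by norm_num)

theorem boundedMeasurable_eight_pow_backs (a n : ℕ) :
    BoundedMeasurable fun ω => (8 : ℝ) ^ backs q ω a n :=
  boundedMeasurable_pow (measurable_backs a n) (fun ω => backs_le ω a n) (by norm_num)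

theorem boundedMeasurable_back (n : ℕ) : BoundedMeasurable fun ω => (back q ω n : ℝ) :=
  ⟨(measurable_from_top (f := fun k : ℕ => (k : ℝ))).comp (measurable_back n), 1, fun ω => by
    rw [abs_of_nonneg (by positivity)]
    exact Nat.cast_le_one.2 (back_le_one ω n)⟩

theorem integral_back (h0 : 0 ≤ q) (h1 : q ≤ 1) (n : ℕ) :
    ∫ ω, (back q ω n : ℝ) ∂driverLaw p = q := by
  have hmp := measurePreserving_eval_infinitePi (fun i : ℕ × Fin 3 => coordLaw p i.2) (n, 0)
  have : (fun ω => (back q ω n : ℝ)) =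
      Set.indicator ((fun ω : Driver => ω (n, 0)) ⁻¹' Set.Iio q) 1 := by
    funext ω
    by_cases h : ω (n, 0) < q <;> simp [back, h, Set.indicator]
  rw [this, integral_indicator_one (measurable_pi_apply _ measurableSet_Iio), measureReal_def]
  have e := hmp.measure_preimage (measurableSet_Iio (a := q)).nullMeasurableSet
  have e2 : coordLaw p ((n, 0) : ℕ × Fin 3).2 = uniformLaw := if_neg (by simp)
  rw [e2, uniformLaw_Iio h1] at e
  refine (congrArg ENNReal.toReal e).trans (ENNReal.toReal_ofReal h0)

theorem integral_mul_back (h0 : 0 ≤ q) (h1 : q ≤ 1) {n : ℕ} {f : Driver → ℝ}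
    (hf : BoundedMeasurable f) {S : Set (ℕ × Fin 3)} (hS : DependsOn f S) (hn : (n, 0) ∉ S) :
    ∫ ω, f ω * (back q ω n : ℝ) ∂driverLaw p = (∫ ω, f ω ∂driverLaw p) * q := by
  rw [integral_mul_of_dependsOn p hf.1 (boundedMeasurable_back n).1 hS
    (fun ω ω' h => congrArg (Nat.cast (R := ℝ)) (dependsOn_back (q := q) n h))
    (Set.disjoint_singleton_right.2 hn), integral_back p h0 h1]

/-- Conditioning on the last step gives `E (n + 1) ≤ (1 + 3q) / 2 * E n + (1 - q) / 2`. The bound `1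
+ 3q` is preserved exactly when `9 q ^ 2 ≤ q`, which is the origin of `1 / 9`. -/
theorem integral_two_pow_deficit_le (h0 : 0 ≤ q) (h1 : q ≤ 1 / 9) (n : ℕ) :
    ∫ ω, (2 : ℝ) ^ deficit q ω n ∂driverLaw p ≤ 1 + 3 * q := by
  induction n with
  | zero => simp [deficit, h0]
  | succ n ih =>
    have hb := boundedMeasurable_back (q := q) n
    have hd := boundedMeasurable_two_pow_deficit (q := q) n
    -- A backward step doubles the power. A forward step halves it, except at deficit zero, where
    -- the extra `1 / 2` compensates.
    have hpt : ∀ ω, (2 : ℝ) ^ deficit q ω (n + 1) ≤ 1 / 2 * (2 : ℝ) ^ deficit q ω n +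
        (3 / 2 * ((2 : ℝ) ^ deficit q ω n * back q ω n) + (1 / 2 - 1 / 2 * back q ω n)) := by
      intro ω
      by_cases h : ω (n, 0) < q
      · simp only [deficit, back, h, if_true, pow_succ]; push_cast; linarith
      · simp only [deficit, back, h, if_false]
        rcases hdn : deficit q ω n with _ | k
        · norm_num
        · simp only [Nat.add_sub_cancel, pow_succ]; push_cast; linarith
    have hI := integral_mono ((boundedMeasurable_two_pow_deficit (q := q) (n + 1)).integrable p)
      (((((boundedMeasurable_const (1 / 2)).mul hd).add (((boundedMeasurable_const (3 / 2)).mul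
        (hd.mul hb)).add ((boundedMeasurable_const (1 / 2)).sub
        ((boundedMeasurable_const (1 / 2)).mul hb))))).integrable p) hpt
    refine hI.trans ?_
    rw [integral_add (((boundedMeasurable_const (1 / 2)).mul hd).integrable p)
      ((((boundedMeasurable_const (3 / 2)).mul (hd.mul hb)).add ((boundedMeasurable_const (1 / 2)).sub
        ((boundedMeasurable_const (1 / 2)).mul hb))).integrable p),
      integral_add (((boundedMeasurable_const (3 / 2)).mul (hd.mul hb)).integrable p)
        (((boundedMeasurable_const (1 / 2)).sub
        ((boundedMeasurable_const (1 / 2)).mul hb)).integrable p),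
      integral_sub ((boundedMeasurable_const (1 / 2)).integrable p)
        (((boundedMeasurable_const (1 / 2)).mul hb).integrable p),
      integral_const_mul, integral_const_mul, integral_const_mul, integral_back p h0 (by linarith),
      integral_mul_back p h0 (by linarith) hd
        (fun ω ω' h => congrArg (fun k => (2 : ℝ) ^ k) (dependsOn_deficit (q := q) n h)) (by simp)]
    simp only [integral_const, probReal_univ, smul_eq_mul]
    nlinarith

/-- The steps from `a` on are independent of `f` and of each other, and each contributes the mean `1
+ 7q` of `8 ^ back`. -/
theorem integral_mul_eight_pow_backs (h0 : 0 ≤ q) (h1 : q ≤ 1) {a n : ℕ} (h : a ≤ n)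
    {f : Driver → ℝ} (hf : BoundedMeasurable f) (hS : DependsOn f {i | i.2 = 0 ∧ i.1 < a}) :
    ∫ ω, f ω * (8 : ℝ) ^ backs q ω a n ∂driverLaw p =
      (∫ ω, f ω ∂driverLaw p) * (1 + 7 * q) ^ (n - a) := by
  induction n, h using Nat.le_induction with
  | base => simp [backs_self]
  | succ n hn ih =>
    have hg := hf.mul (boundedMeasurable_eight_pow_backs (q := q) a n)
    have hpt : ∀ ω, f ω * (8 : ℝ) ^ backs q ω a (n + 1) = f ω * (8 : ℝ) ^ backs q ω a n +
        7 * (f ω * (8 : ℝ) ^ backs q ω a n * back q ω n) := by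
      intro ω
      rw [backs_succ hn, pow_add]
      unfold back
      split_ifs
      · simp; ring
      · simp
    have hdep : DependsOn (fun ω => f ω * (8 : ℝ) ^ backs q ω a n) {i | i.2 = 0 ∧ i.1 < n} := by
      intro ω ω' h'
      have e1 : f ω = f ω' := hS fun i hi => h' i ⟨hi.1, hi.2.trans_le hn⟩
      have e2 : backs q ω a n = backs q ω' a n :=
        dependsOn_backs a n fun i hi => h' i ⟨hi.1, hi.2.2⟩
      simp only [e1, e2]
    simp_rw [hpt]
    rw [integral_add (hg.integrable p)
      (((boundedMeasurable_const 7).mul (hg.mul (boundedMeasurable_back n))).integrable p),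
      integral_const_mul, integral_mul_back p h0 h1 hg hdep (by simp), ih,
      show n + 1 - a = n - a + 1 by omega, pow_succ]
    ring

theorem integral_eight_pow_backs (h0 : 0 ≤ q) (h1 : q ≤ 1) {a n : ℕ} (h : a ≤ n) :
    ∫ ω, (8 : ℝ) ^ backs q ω a n ∂driverLaw p = (1 + 7 * q) ^ (n - a) := by
  have := integral_mul_eight_pow_backs p h0 h1 h (boundedMeasurable_const 1) (fun _ _ _ => rfl)
  simpa using this

/-- It is exponentially unlikely that a long time interval contains no cut time. -/
theorem measureReal_forall_not_isCut_le (h0 : 0 ≤ q) (h1 : q ≤ 1 / 9) {a n : ℕ} (h : a ≤ n) :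
    (driverLaw p).real {ω | ∀ k, a ≤ k → k ≤ n → ¬ IsCut q ω k n} ≤
      (1 + 3 * q) * ((1 + 7 * q) / 2) ^ (n - a) := by
  have hm : MeasurableSet {ω | ∀ k, a ≤ k → k ≤ n → ¬ IsCut q ω k n} := by
    simp only [Set.ofPred_forall]
    exact .iInter fun k => .iInter fun _ => .iInter fun _ => (measurableSet_isCut k n).compl
  have hd := boundedMeasurable_two_pow_deficit (q := q) a
  have hg := hd.mul (boundedMeasurable_eight_pow_backs (q := q) a n)
  rw [← integral_indicator_one hm]
  -- Exponential Markov inequality: without a cut time, `n - a ≤ 3 * backs + deficit`, so `2` to the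
  -- difference is at least `1`.
  have hpt : ∀ ω, Set.indicator {ω | ∀ k, a ≤ k → k ≤ n → ¬ IsCut q ω k n} (1 : Driver → ℝ) ω ≤
      (1 / 2) ^ (n - a) * ((2 : ℝ) ^ deficit q ω a * (8 : ℝ) ^ backs q ω a n) := by
    intro ω
    by_cases hω : ∀ k, a ≤ k → k ≤ n → ¬ IsCut q ω k n
    · rw [Set.indicator_of_mem (by exact hω)]
      have := le_of_forall_not_isCut h hω
      rw [show (8 : ℝ) = 2 ^ 3 by norm_num, ← pow_mul, ← pow_add, one_div, inv_pow, Pi.one_apply,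
        inv_mul_eq_div, one_le_div (by positivity)]
      exact pow_le_pow_right₀ (by norm_num) (by omega)
    · rw [Set.indicator_of_notMem (by exact hω)]
      positivity
  refine (integral_mono ?_ (((boundedMeasurable_const _).mul hg).integrable p) hpt).trans ?_
  · exact (integrable_const (1 : ℝ)).indicator hm
  · rw [integral_const_mul, integral_mul_eight_pow_backs p h0 (by linarith) h hd
      (fun ω ω' h => congrArg (fun k => (2 : ℝ) ^ k) (dependsOn_deficit (q := q) a h))]
    have := integral_two_pow_deficit_le p h0 h1 a
    have e : (1 / 2 : ℝ) ^ (n - a) * ((∫ ω, (2 : ℝ) ^ deficit q ω a ∂driverLaw p) *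
        (1 + 7 * q) ^ (n - a)) = (∫ ω, (2 : ℝ) ^ deficit q ω a ∂driverLaw p) *
        ((1 + 7 * q) / 2) ^ (n - a) := by
      rw [div_pow, div_pow, one_pow]; ring
    rw [e]
    exact mul_le_mul_of_nonneg_right this (by positivity)

end Moments

/-! ### Comparison of two walks -/

section Comparison

variable {g g' : ℕ → ℝ} {q : ℝ} (p : PMF ℕ)

/-- The indicator of the event that the driver at time `j` separates two walks at a vertex that has
been discovered at time `i`. -/
noncomputable def separation (g g' : ℕ → ℝ) (i j : ℕ) (ω : Driver) : ℝ :=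
  if g' (offspring ω i) ≤ ω (j, 0) ∧ ω (j, 0) < g (offspring ω i) then 1 else 0

/-- The probability that two walks are separated at a new vertex. -/
noncomputable def separationProb (p : PMF ℕ) (g g' : ℕ → ℝ) : ℝ :=
  ∫ x : ℝ × ℝ, (if g' ⌊x.2⌋₊ ≤ x.1 ∧ x.1 < g ⌊x.2⌋₊ then (1 : ℝ) else 0)
    ∂uniformLaw.prod (coordLaw p 2)

theorem separation_nonneg (i j : ℕ) (ω : Driver) : 0 ≤ separation g g' i j ω := by
  unfold separation; split_ifs <;> norm_num

theorem measurableSet_separation :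
    MeasurableSet {x : ℝ × ℝ | g' ⌊x.2⌋₊ ≤ x.1 ∧ x.1 < g ⌊x.2⌋₊} := by
  have h : ∀ f : ℕ → ℝ, Measurable fun x : ℝ × ℝ => f ⌊x.2⌋₊ := fun f =>
    (measurable_from_top (f := f)).comp (Nat.measurable_floor.comp measurable_snd)
  exact (measurableSet_le (h g') measurable_fst).inter (measurableSet_lt measurable_fst (h g))

theorem boundedMeasurable_separation (i j : ℕ) : BoundedMeasurable (separation g g' i j) := by
  refine ⟨Measurable.ite ?_ measurable_const measurable_const, 1, fun ω => ?_⟩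
  · exact (measurableSet_separation (g := g) (g' := g')).preimage
      (f := fun ω : Driver => (ω (j, 0), ω (i, 2)))
      ((measurable_pi_apply _).prodMk (measurable_pi_apply _))
  · unfold separation; split_ifs <;> simp

theorem dependsOn_separation (i j : ℕ) :
    DependsOn (separation g g' i j) {(j, 0), (i, 2)} := by
  intro ω ω' h
  exact if_congr (by simp only [offspring, h (j, 0) (by simp), h (i, 2) (by simp)]) rfl rfl

theorem integral_separation (i j : ℕ) :
    ∫ ω, separation g g' i j ω ∂driverLaw p = separationProb p g g' := by
  have hne : ((j, 0) : ℕ × Fin 3) ≠ (i, 2) := by simp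
  have h := Measure.infinitePi_map_eval_prod (P := fun i : ℕ × Fin 3 => coordLaw p i.2) hne
  have e : coordLaw p ((j, 0) : ℕ × Fin 3).2 = uniformLaw := if_neg (by simp)
  rw [separationProb, ← e, ← show _ = (coordLaw p 0).prod (coordLaw p 2) from h, integral_map]
  · rfl
  · exact ((measurable_pi_apply _).prodMk (measurable_pi_apply _)).aemeasurable
  · exact (Measurable.ite measurableSet_separation measurable_const
      measurable_const).aestronglyMeasurable

/-- Some `k` has `p k > 0`, and for this `k` the interval `[g' k, g k)` has positive length and lies
in `[0, 1]`. -/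
theorem separationProb_pos (h0 : ∀ k, 0 ≤ g' k) (hgg : ∀ k, g' k < g k) (h1 : ∀ k, g k ≤ 1) :
    0 < separationProb p g g' := by
  obtain ⟨k, hk⟩ := p.support_nonempty
  have hk' : 0 < p k := pos_iff_ne_zero.2 ((p.mem_support_iff k).1 hk)
  have hint : (fun x : ℝ × ℝ => if g' ⌊x.2⌋₊ ≤ x.1 ∧ x.1 < g ⌊x.2⌋₊ then (1 : ℝ) else 0) =
      Set.indicator {x : ℝ × ℝ | g' ⌊x.2⌋₊ ≤ x.1 ∧ x.1 < g ⌊x.2⌋₊} 1 := by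
    funext x; simp [Set.indicator]
  rw [separationProb, hint, integral_indicator_one measurableSet_separation, measureReal_def]
  refine ENNReal.toReal_pos (ne_of_gt ?_) (measure_ne_top _ _)
  have hsub : Set.Ico (g' k) (g k) ×ˢ {(k : ℝ)} ⊆
      {x : ℝ × ℝ | g' ⌊x.2⌋₊ ≤ x.1 ∧ x.1 < g ⌊x.2⌋₊} := by
    rintro ⟨x, y⟩ ⟨hx, rfl⟩
    simpa using hx
  refine lt_of_lt_of_le ?_ (measure_mono hsub)
  rw [Measure.prod_prod, uniformLaw_Ico (h0 k) (h1 k)]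
  refine ENNReal.mul_pos (by simpa using hgg k) (ne_of_gt (hk'.trans_le ?_))
  rw [coordLaw, if_pos rfl, Measure.map_apply measurable_from_top (.singleton _)]
  have : (fun k : ℕ => (k : ℝ)) ⁻¹' {(k : ℝ)} = {k} := by ext; simp
  rw [this, PMF.toMeasure_apply_singleton _ _ (.singleton _)]

/-- An upper bound of the indicator of the event that the walks have been separated at time `j`, at a
vertex discovered at time `i`, and that the gain is lost at time `m`. -/
noncomputable def lossWeight (q : ℝ) (g g' : ℕ → ℝ) (m j i : ℕ) (ω : Driver) : ℝ :=
  16 * (1 / 2) ^ (m - i) * ((2 : ℝ) ^ deficit q ω i * (8 : ℝ) ^ backs q ω i j *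
    separation g g' i j ω * ((8 : ℝ) ^ backs q ω (j + 1) m * back q ω m))

theorem lossWeight_nonneg (m j i : ℕ) (ω : Driver) : 0 ≤ lossWeight q g g' m j i ω := by
  have := separation_nonneg (g := g) (g' := g') i j ω
  unfold lossWeight; positivity

theorem boundedMeasurable_lossWeight (m j i : ℕ) :
    BoundedMeasurable (lossWeight q g g' m j i) :=
  (boundedMeasurable_const _).mul
    ((((boundedMeasurable_two_pow_deficit i).mul (boundedMeasurable_eight_pow_backs i j)).mul
      (boundedMeasurable_separation i j)).mul
      ((boundedMeasurable_eight_pow_backs (j + 1) m).mul (boundedMeasurable_back m)))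

theorem separationProb_nonneg : 0 ≤ separationProb p g g' := by
  rw [← integral_separation p 0 0]
  exact integral_nonneg fun ω => separation_nonneg 0 0 ω

/-- The factors involve disjoint coordinates: uniform variables before `j`, the pair `(j, 0), (i,
2)`, uniform variables strictly between `j` and `m`, and that of `m`. Leaving time `j` out of both
counts of backward steps in `lossWeight` is what makes the separation independent of the rest. -/
theorem integral_lossWeight_le (h0 : 0 ≤ q) (h1 : q ≤ 1 / 9) {i j m : ℕ} (hij : i ≤ j)
    (hjm : j < m) : ∫ ω, lossWeight q g g' m j i ω ∂driverLaw p ≤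
      8 * q * (1 + 3 * q) * separationProb p g g' *
        (((1 + 7 * q) / 2) ^ (m - 1 - j) * ((1 + 7 * q) / 2) ^ (j - i)) := by
  have hd := boundedMeasurable_two_pow_deficit (q := q) i
  have hA := hd.mul (boundedMeasurable_eight_pow_backs (q := q) i j)
  have hz := boundedMeasurable_separation (g := g) (g' := g') i j
  have hB := boundedMeasurable_eight_pow_backs (q := q) (j + 1) m
  have dA : DependsOn (fun ω => (2 : ℝ) ^ deficit q ω i * (8 : ℝ) ^ backs q ω i j)
      {i | i.2 = 0 ∧ i.1 < j} := by
    intro ω ω' h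
    have e1 : deficit q ω i = deficit q ω' i :=
      dependsOn_deficit i fun k hk => h k ⟨hk.1, hk.2.trans_le hij⟩
    have e2 : backs q ω i j = backs q ω' i j :=
      dependsOn_backs i j fun k hk => h k ⟨hk.1, hk.2.2⟩
    simp only [e1, e2]
  have dB : DependsOn (fun ω => (8 : ℝ) ^ backs q ω (j + 1) m)
      {i | i.2 = 0 ∧ j + 1 ≤ i.1 ∧ i.1 < m} := fun ω ω' h =>
    congrArg (fun k => (8 : ℝ) ^ k) (dependsOn_backs (q := q) (j + 1) m h)
  have dAz : DependsOn (fun ω => (2 : ℝ) ^ deficit q ω i * (8 : ℝ) ^ backs q ω i j *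
      separation g g' i j ω) {i | i.1 ≤ j} := by
    intro ω ω' h
    have e1 := dA fun k hk => h k (Nat.le_of_lt hk.2)
    have e2 : separation g g' i j ω = separation g g' i j ω' :=
      dependsOn_separation i j fun k hk => h k (by
        rcases hk with rfl | hk
        · exact le_refl j
        · rw [Set.mem_singleton_iff] at hk; subst hk; exact hij)
    simp only at e1
    simp only [e1, e2]
  have dBb : DependsOn (fun ω => (8 : ℝ) ^ backs q ω (j + 1) m * (back q ω m : ℝ))
      {i | j < i.1} := by
    intro ω ω' h
    have e1 := dB fun k hk => h k (Nat.lt_of_succ_le hk.2.1)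
    have e2 : back q ω m = back q ω' m :=
      dependsOn_back m fun k hk => h k (by rw [Set.mem_singleton_iff] at hk; subst hk; exact hjm)
    simp only at e1
    simp only [e1, e2]
  have hdisj : Disjoint {k : ℕ × Fin 3 | k.1 ≤ j} {k | j < k.1} :=
    Set.disjoint_left.2 fun k (hk : k.1 ≤ j) hk' => absurd hk' (not_lt.2 hk)
  have hdisj' : Disjoint {k : ℕ × Fin 3 | k.2 = 0 ∧ k.1 < j} {(j, 0), (i, 2)} := by
    refine Set.disjoint_left.2 ?_
    rintro k ⟨hk1, hk2⟩ (rfl | rfl)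
    · simp at hk2
    · simp at hk1
  unfold lossWeight
  rw [integral_const_mul, integral_mul_of_dependsOn p (hA.mul hz).1
    (hB.mul (boundedMeasurable_back m)).1 dAz dBb hdisj,
    integral_mul_of_dependsOn p hA.1 hz.1 dA (dependsOn_separation i j) hdisj',
    integral_separation, integral_mul_eight_pow_backs p h0 (by linarith) hij hd
      (fun ω ω' h => congrArg (fun k => (2 : ℝ) ^ k) (dependsOn_deficit (q := q) i h)),
    integral_mul_back p h0 (by linarith) hB dB (by simp),
    integral_eight_pow_backs p h0 (by linarith) hjm]
  have hI := integral_two_pow_deficit_le p h0 h1 i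
  have hD := separationProb_nonneg (g := g) (g' := g') p
  -- The exponents `m - 1 - j` and `j - i` add up to `m - i - 1`. The spare factor `1 / 2` turns
  -- `16` into `8`.
  have e : (1 / 2 : ℝ) ^ (m - i) = 1 / 2 * ((1 / 2) ^ (m - 1 - j) * (1 / 2) ^ (j - i)) := by
    rw [← pow_add, ← pow_succ']; congr 1; omega
  have e' : m - (j + 1) = m - 1 - j := by omega
  rw [e, e', div_eq_mul_one_div (1 + 7 * q), mul_pow, mul_pow]
  set I := ∫ ω, (2 : ℝ) ^ deficit q ω i ∂driverLaw p
  set D := separationProb p g g'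
  have hX : 0 ≤ 8 * q * D * (((1 + 7 * q) ^ (m - 1 - j) * (1 / 2) ^ (m - 1 - j)) *
      ((1 + 7 * q) ^ (j - i) * (1 / 2) ^ (j - i))) := by positivity
  calc _ = I * (8 * q * D * (((1 + 7 * q) ^ (m - 1 - j) * (1 / 2) ^ (m - 1 - j)) *
      ((1 + 7 * q) ^ (j - i) * (1 / 2) ^ (j - i)))) := by ring
    _ ≤ (1 + 3 * q) * _ := mul_le_mul_of_nonneg_right hI hX
    _ = _ := by ring

/-- The absence of cut times bounds `m - j` by three times the backward steps from `j + 1` on plus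
the deficit at `j + 1`, which is at most the deficit at `i` plus the backward steps since. The
comparison walk has not risen between `i` and `j`, so `j - i` is at most twice the backward steps
there. In total `m - i ≤ 4 + deficit i + 3 backs i j + 3 backs (j + 1) m`. Of the `4`, hence of the
factor `16 = 2 ^ 4`, three come from the backward step at `m` and one from a possible one at `j`. -/
theorem one_le_lossWeight {m j i : ℕ} {ω : Driver} (hij : i ≤ j) (hjm : j < m)
    (hh : height q ω j ≤ height q ω i) (hs : separation g g' i j ω = 1) (hm : ω (m, 0) < q)
    (hc : ∀ k, j + 1 ≤ k → k ≤ m + 1 → ¬ IsCut q ω k (m + 1)) :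
    1 ≤ lossWeight q g g' m j i ω := by
  have hb : back q ω m = 1 := by simp [back, hm]
  have h1 := le_of_forall_not_isCut (q := q) (ω := ω) (show j + 1 ≤ m + 1 by omega) hc
  have h2 := height_sub_eq (q := q) (ω := ω) hij
  have h3 := deficit_le (q := q) (ω := ω) (show i ≤ j + 1 by omega)
  have h4 := backs_succ (q := q) (ω := ω) hij
  have h5 := backs_succ (q := q) (ω := ω) (show j + 1 ≤ m by omega)
  have h6 := back_le_one (q := q) ω j
  have e : lossWeight q g g' m j i ω =
      (1 / 2) ^ (m - i) * 2 ^ (4 + deficit q ω i + 3 * backs q ω i j + 3 * backs q ω (j + 1) m) := by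
    rw [lossWeight, hs, hb, show (8 : ℝ) = 2 ^ 3 by norm_num, ← pow_mul, ← pow_mul, pow_add,
      pow_add, pow_add]
    norm_num
    ring
  rw [e, one_div, inv_pow, inv_mul_eq_div, one_le_div (by positivity)]
  exact pow_le_pow_right₀ (by norm_num) (by omega)

/-- The factor `2 - 2 ^ deficit - back` equals `1` if `m + 1` is made a record by a forward step
from deficit zero, and is at most `0` otherwise. It is thus a lower bound for the indicator of a
gain with an easily bounded mean. Increments are `±1`, so each gain or loss is `2`, and a loss is
paid for by some `lossWeight ≥ 1`. -/
theorem incr_sub_incr_ge (hg : ∀ k, g k ≤ q) (hgg : ∀ k, g' k ≤ g k) (m : ℕ) (ω : Driver) :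
    2 * (separation g g' (m + 1) (m + 1) ω * (2 - 2 ^ deficit q ω m - back q ω m)) -
      2 * ∑ j ∈ range (m + 1), ∑ i ∈ range (j + 1), lossWeight q g g' (m + 1) j i ω ≤
    incr g' ω (m + 1) - incr g ω (m + 1) := by
  have hsum : 0 ≤ ∑ j ∈ range (m + 1), ∑ i ∈ range (j + 1), lossWeight q g g' (m + 1) j i ω :=
    sum_nonneg fun j _ => sum_nonneg fun i _ => lossWeight_nonneg _ _ _ _
  have hfac : (2 : ℝ) - 2 ^ deficit q ω m - back q ω m ≤ 1 := by
    have : (1 : ℝ) ≤ 2 ^ deficit q ω m := one_le_pow₀ (by norm_num)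
    have : (0 : ℝ) ≤ back q ω m := Nat.cast_nonneg _
    linarith
  by_cases hgain : (g' (offspring ω (m + 1)) ≤ ω (m + 1, 0) ∧
      ω (m + 1, 0) < g (offspring ω (m + 1))) ∧ deficit q ω m = 0 ∧ q ≤ ω (m, 0)
  · obtain ⟨hz, hd, hu⟩ := hgain
    rw [incr_sub_incr_of_record hg (fun k => (hgg k).trans (hg k)) (by omega)
      (record_of_deficit_eq_zero hd hu) hz.1 hz.2, separation, if_pos hz]
    linarith
  · have hfirst : separation g g' (m + 1) (m + 1) ω * (2 - 2 ^ deficit q ω m - back q ω m) ≤ 0 := by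
      by_cases hz : g' (offspring ω (m + 1)) ≤ ω (m + 1, 0) ∧
        ω (m + 1, 0) < g (offspring ω (m + 1))
      · refine mul_nonpos_of_nonneg_of_nonpos (separation_nonneg _ _ _) ?_
        by_cases hu : ω (m, 0) < q
        · have : (1 : ℝ) ≤ 2 ^ deficit q ω m := one_le_pow₀ (by norm_num)
          simp only [back, if_pos hu]; push_cast; linarith
        · have hd : 1 ≤ deficit q ω m := by
            by_contra h
            exact hgain ⟨hz, by omega, not_lt.1 hu⟩
          have : (2 : ℝ) ^ 1 ≤ 2 ^ deficit q ω m := pow_le_pow_right₀ (by norm_num) hd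
          simp only [back, if_neg hu]; push_cast; linarith
      · rw [separation, if_neg hz, zero_mul]
    rcases lt_or_ge (incr g' ω (m + 1)) (incr g ω (m + 1)) with hlt | hge
    · obtain ⟨hm, j, hj, i, hi, hh, hs1, hs2, hc⟩ := exists_of_incr_lt hg hgg hlt
      have h1 : 1 ≤ lossWeight q g g' (m + 1) j i ω :=
        one_le_lossWeight hi hj hh (if_pos ⟨hs1, hs2⟩) hm hc
      have h2 : lossWeight q g g' (m + 1) j i ω ≤
          ∑ j ∈ range (m + 1), ∑ i ∈ range (j + 1), lossWeight q g g' (m + 1) j i ω :=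
        (single_le_sum (f := fun i => lossWeight q g g' (m + 1) j i ω)
          (fun i _ => lossWeight_nonneg _ _ _ _) (mem_range.2 (Nat.lt_succ_of_le hi))).trans
          (single_le_sum (f := fun j => ∑ i ∈ range (j + 1), lossWeight q g g' (m + 1) j i ω)
          (fun j _ => sum_nonneg fun i _ => lossWeight_nonneg _ _ _ _) (mem_range.2 hj))
      rcases incr_eq (g := g) (ω := ω) (m + 1) with e | e <;>
        rcases incr_eq (g := g') (ω := ω) (m + 1) with e' | e' <;> rw [e, e'] <;> linarith
    · linarith

theorem boundedMeasurable_incr (n : ℕ) : BoundedMeasurable fun ω => incr g ω n :=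
  ⟨measurable_incr n, 1, fun ω => by
    rcases incr_eq (g := g) (ω := ω) n with e | e <;> simp [e]⟩

theorem geom_sum_reflect_le {r : ℝ} (h0 : 0 ≤ r) (h1 : r < 1) (n : ℕ) :
    ∑ i ∈ range (n + 1), r ^ (n - i) ≤ 1 / (1 - r) := by
  have h := sum_range_reflect (fun i => r ^ i) (n + 1)
  simp only [Nat.add_sub_cancel] at h
  rw [h, one_div, ← tsum_geometric_of_lt_one h0 h1]
  exact (summable_geometric_of_lt_one h0 h1).sum_le_tsum _ fun i _ => pow_nonneg h0 i

/-- The walk with the smaller probabilities to step back gains on average at every time. -/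
theorem integral_incr_add_le (h0 : 0 ≤ q) (h1 : q ≤ 1 / 718) (hg : ∀ k, g k ≤ q)
    (hgg : ∀ k, g' k ≤ g k) (m : ℕ) :
    ∫ ω, incr g ω (m + 1) ∂driverLaw p + separationProb p g g' ≤
      ∫ ω, incr g' ω (m + 1) ∂driverLaw p := by
  have hz := boundedMeasurable_separation (g := g) (g' := g') (m + 1) (m + 1)
  have hd := boundedMeasurable_two_pow_deficit (q := q) m
  have hb := boundedMeasurable_back (q := q) m
  have hf := ((boundedMeasurable_const 2).sub hd).sub hb
  have hL : BoundedMeasurable fun ω => ∑ j ∈ range (m + 1), ∑ i ∈ range (j + 1),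
      lossWeight q g g' (m + 1) j i ω :=
    .sum _ fun j _ => .sum _ fun i _ => boundedMeasurable_lossWeight _ _ _
  have hI := integral_mono ((((boundedMeasurable_const 2).mul (hz.mul hf)).sub
    ((boundedMeasurable_const 2).mul hL)).integrable p)
    (((boundedMeasurable_incr (g := g') (m + 1)).sub
      (boundedMeasurable_incr (g := g) (m + 1))).integrable p) (incr_sub_incr_ge hg hgg m)
  have hdep : DependsOn (fun ω => (2 : ℝ) - 2 ^ deficit q ω m - back q ω m)
      {i | i.2 = 0 ∧ i.1 < m + 1} := by
    intro ω ω' h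
    have e1 : deficit q ω m = deficit q ω' m :=
      dependsOn_deficit m fun k hk => h k ⟨hk.1, Nat.lt_succ_of_lt hk.2⟩
    have e2 : back q ω m = back q ω' m := dependsOn_back m fun k hk => h k (by
      rw [Set.mem_singleton_iff] at hk; subst hk; exact ⟨rfl, Nat.lt_succ_self m⟩)
    simp only [e1, e2]
  have hdisj : Disjoint {(m + 1, 0), (m + 1, 2)} {k : ℕ × Fin 3 | k.2 = 0 ∧ k.1 < m + 1} := by
    refine Set.disjoint_left.2 ?_
    rintro k (rfl | rfl) ⟨hk1, hk2⟩
    · simp at hk2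
    · simp at hk1
  rw [integral_sub ((boundedMeasurable_incr (m + 1)).integrable p)
      ((boundedMeasurable_incr (m + 1)).integrable p),
    integral_sub (((boundedMeasurable_const 2).mul (hz.mul hf)).integrable p)
      (((boundedMeasurable_const 2).mul hL).integrable p), integral_const_mul, integral_const_mul,
    integral_mul_of_dependsOn p hz.1 hf.1 (dependsOn_separation _ _) hdep hdisj,
    integral_separation, integral_sub (((boundedMeasurable_const 2).sub hd).integrable p)
      (hb.integrable p), integral_sub ((boundedMeasurable_const 2).integrable p) (hd.integrable p),
    integral_back p h0 (by linarith), integral_finsetSum _ fun j _ =>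
      (BoundedMeasurable.sum _ fun i _ => boundedMeasurable_lossWeight _ _ _).integrable p] at hI
  simp only [integral_const, probReal_univ, smul_eq_mul, one_mul] at hI
  set Δ := separationProb p g g' with hΔ
  have hΔ0 : 0 ≤ Δ := separationProb_nonneg p
  set r := (1 + 7 * q) / 2 with hr
  have hr0 : 0 ≤ r := by positivity
  have hr1 : r ≤ 3 / 5 := by rw [hr]; linarith
  have hgeo : ∀ n, ∑ i ∈ range (n + 1), r ^ (n - i) ≤ 5 / 2 := fun n => by
    refine (geom_sum_reflect_le hr0 (by linarith) n).trans ?_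
    rw [div_le_div_iff₀ (by linarith) (by norm_num)]; linarith
  -- The two geometric sums, each at most `5 / 2`, give the loss `8 * (5 / 2) ^ 2 * q (1 + 3q) Δ =
  -- 50 q (1 + 3q) Δ`, below `Δ / 10` for `q ≤ 1 / 718`.
  have hloss : ∑ j ∈ range (m + 1), ∫ ω, ∑ i ∈ range (j + 1), lossWeight q g g' (m + 1) j i ω
      ∂driverLaw p ≤ Δ / 10 := by
    have hstep : ∀ j ∈ range (m + 1), ∫ ω, ∑ i ∈ range (j + 1), lossWeight q g g' (m + 1) j i ω
        ∂driverLaw p ≤ 8 * q * (1 + 3 * q) * Δ * (5 / 2) * r ^ (m - j) := by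
      intro j hj
      rw [integral_finsetSum _ fun i _ => (boundedMeasurable_lossWeight _ _ _).integrable p]
      have : ∀ i ∈ range (j + 1), ∫ ω, lossWeight q g g' (m + 1) j i ω ∂driverLaw p ≤
          8 * q * (1 + 3 * q) * Δ * r ^ (m - j) * r ^ (j - i) := fun i hi => by
        have h := integral_lossWeight_le (g := g) (g' := g') p h0 (by linarith : q ≤ 1 / 9)
          (Nat.lt_succ_iff.1 (mem_range.1 hi)) (mem_range.1 hj)
        rw [Nat.add_sub_cancel] at h
        linarith
      refine (sum_le_sum this).trans ?_
      rw [← mul_sum]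
      have h2 := mul_le_mul_of_nonneg_left (hgeo j)
        (show 0 ≤ 8 * q * (1 + 3 * q) * Δ * r ^ (m - j) by positivity)
      linarith
    refine (sum_le_sum hstep).trans ?_
    rw [← mul_sum]
    have h2 := mul_le_mul_of_nonneg_left (hgeo m)
        (show 0 ≤ 8 * q * (1 + 3 * q) * Δ * (5 / 2) by positivity)
    have h3 : q * (1 + 3 * q) ≤ 1 / 718 * (1 + 3 * (1 / 718)) :=
      mul_le_mul h1 (by linarith) (by positivity) (by norm_num)
    have h4 := mul_le_mul_of_nonneg_right h3 hΔ0
    nlinarith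
  have hI2 := integral_two_pow_deficit_le p h0 (by linarith : q ≤ 1 / 9) m
  -- The mean of the gain factor is at least `1 - 4q ≥ 9 / 10`, so the net gain is at least `2 * (9
  -- / 10) Δ - 2 * (1 / 10) Δ ≥ Δ`.
  have h5 : Δ * (9 / 10) ≤ Δ * (2 - ∫ ω, (2 : ℝ) ^ deficit q ω m ∂driverLaw p - q) :=
    mul_le_mul_of_nonneg_left (by linarith) hΔ0
  linarith

end Comparison

/-! ### A law of large numbers -/

section LawOfLargeNumbers

/-- A sequence of random variables whose normalised second moments are `O(1 / n)` converges to zero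
along the squares. -/
theorem ae_tendsto_div_sq {Ω : Type*} [MeasurableSpace Ω] {μ : Measure Ω}
    {S : ℕ → Ω → ℝ} (hS : ∀ n, Measurable (S n)) (hSi : ∀ n, Integrable (fun ω => S n ω ^ 2) μ)
    {K : ℝ} (hK : ∀ n, ∫ ω, S n ω ^ 2 ∂μ ≤ K * n) :
    ∀ᵐ ω ∂μ, Tendsto (fun n : ℕ => S ((n + 1) ^ 2) ω / ((n + 1) ^ 2 : ℕ)) atTop (𝓝 0) := by
  have hmeas : ∀ n : ℕ, Measurable fun ω =>
      ENNReal.ofReal ((S ((n + 1) ^ 2) ω / ((n + 1) ^ 2 : ℕ)) ^ 2) := fun n =>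
    ENNReal.measurable_ofReal.comp (((hS _).div_const _).pow_const 2)
  have hterm : ∀ n : ℕ, ∫⁻ ω, ENNReal.ofReal ((S ((n + 1) ^ 2) ω / ((n + 1) ^ 2 : ℕ)) ^ 2) ∂μ ≤
      ENNReal.ofReal (K * (1 / ((n : ℝ) + 1) ^ 2)) := by
    intro n
    have hpos : (0 : ℝ) < ((n + 1) ^ 2 : ℕ) := by positivity
    rw [← ofReal_integral_eq_lintegral_ofReal]
    · refine ENNReal.ofReal_le_ofReal ?_
      simp_rw [div_pow]
      rw [integral_div, div_le_iff₀ (by positivity)]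
      refine (hK _).trans (le_of_eq ?_)
      push_cast
      field_simp
    · simp_rw [div_pow]; exact (hSi _).div_const _
    · exact .of_forall fun ω => sq_nonneg _
  have hsum : Summable fun n : ℕ => K * (1 / ((n : ℝ) + 1) ^ 2) := by
    have h := (summable_nat_add_iff 1).2 (Real.summable_one_div_nat_pow.2 (by norm_num : 1 < 2))
    push_cast at h
    exact h.mul_left K
  have hfin : ∫⁻ ω, ∑' n : ℕ, ENNReal.ofReal ((S ((n + 1) ^ 2) ω / ((n + 1) ^ 2 : ℕ)) ^ 2) ∂μ ≠
      ∞ := by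
    rw [lintegral_tsum fun n => (hmeas n).aemeasurable]
    exact ne_top_of_le_ne_top hsum.tsum_ofReal_ne_top (ENNReal.tsum_le_tsum hterm)
  filter_upwards [ae_lt_top (Measurable.tsum hmeas) hfin] with ω hω
  have h1 := ENNReal.tendsto_atTop_zero_of_tsum_ne_top hω.ne
  have h2 := (ENNReal.tendsto_toReal ENNReal.zero_ne_top).comp h1
  simp only [Function.comp_def, ENNReal.toReal_ofReal (sq_nonneg _), ENNReal.toReal_zero] at h2
  have h3 := h2.sqrt
  simp only [Real.sqrt_sq_eq_abs, Real.sqrt_zero] at h3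
  exact (tendsto_zero_iff_abs_tendsto_zero _).2 h3

variable {Ω : Type*} [MeasurableSpace Ω] {μ : Measure Ω} [IsProbabilityMeasure μ]

/-- The second moment of a sum of bounded centred variables with exponentially decaying correlations
grows at most linearly. -/
theorem integral_sq_sum_le {e : ℕ → Ω → ℝ} (hm : ∀ n, Measurable (e n)) {b : ℝ}
    (hb : ∀ n ω, |e n ω| ≤ b) {C r : ℝ} (hC : 0 ≤ C) (hr0 : 0 ≤ r) (hr1 : r < 1)
    (hcov : ∀ m n, m < n → |∫ ω, e m ω * e n ω ∂μ| ≤ C * r ^ (n - m)) (n : ℕ) :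
    ∫ ω, (∑ m ∈ range n, e m ω) ^ 2 ∂μ ≤ (2 * C / (1 - r) + b ^ 2) * n := by
  have hbd : ∀ (n : ℕ) ω, |∑ m ∈ range n, e m ω| ≤ n * b := fun n ω => by
    refine (abs_sum_le_sum_abs _ _).trans ((sum_le_card_nsmul _ _ b fun m _ => hb m ω).trans ?_)
    simp
  have hSm : ∀ n : ℕ, Measurable fun ω => ∑ m ∈ range n, e m ω := fun n =>
    Finset.measurable_sum _ fun m _ => hm m
  have hprod : ∀ m n, Integrable (fun ω => e m ω * e n ω) μ := fun m n =>
    .of_bound ((hm m).mul (hm n)).aestronglyMeasurable (b * b) (.of_forall fun ω => by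
      rw [Real.norm_eq_abs, abs_mul]
      exact mul_le_mul (hb m ω) (hb n ω) (abs_nonneg _) ((abs_nonneg _).trans (hb m ω)))
  have hSe : ∀ n, Integrable (fun ω => (∑ m ∈ range n, e m ω) * e n ω) μ := fun n => by
    simp_rw [sum_mul]
    exact integrable_finsetSum _ fun m _ => hprod m n
  have hSS : ∀ n : ℕ, Integrable (fun ω => (∑ m ∈ range n, e m ω) ^ 2) μ := fun n =>
    .of_bound ((hSm n).pow_const 2).aestronglyMeasurable ((n * b) ^ 2) (.of_forall fun ω => by
      rw [Real.norm_eq_abs, abs_pow]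
      exact pow_le_pow_left₀ (abs_nonneg _) (hbd n ω) 2)
  induction n with
  | zero => simp
  | succ n ih =>
    have hee : ∫ ω, e n ω * e n ω ∂μ ≤ b ^ 2 := by
      have : ∀ ω, e n ω * e n ω ≤ b ^ 2 := fun ω => by
        rw [← sq, ← sq_abs]
        exact pow_le_pow_left₀ (abs_nonneg _) (hb n ω) 2
      refine (integral_mono (hprod n n) (integrable_const _) this).trans ?_
      simp
    have hcross : ∫ ω, (∑ m ∈ range n, e m ω) * e n ω ∂μ ≤ C / (1 - r) := by
      simp_rw [sum_mul]
      rw [integral_finsetSum _ fun m _ => hprod m n]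
      have h1 : ∀ m ∈ range n, ∫ ω, e m ω * e n ω ∂μ ≤ C * r ^ (n - m) := fun m hm' =>
        (le_abs_self _).trans (hcov m n (mem_range.1 hm'))
      refine (sum_le_sum h1).trans ?_
      have h2 : ∑ m ∈ range n, C * r ^ (n - m) ≤ ∑ m ∈ range (n + 1), C * r ^ (n - m) :=
        sum_le_sum_of_subset_of_nonneg (range_mono (Nat.le_succ n)) fun _ _ _ => by positivity
      refine h2.trans ?_
      rw [← mul_sum, div_eq_mul_one_div C]
      exact mul_le_mul_of_nonneg_left (geom_sum_reflect_le hr0 hr1 n) hC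
    have hexp : ∀ ω, (∑ m ∈ range (n + 1), e m ω) ^ 2 = (∑ m ∈ range n, e m ω) ^ 2 +
        (2 * ((∑ m ∈ range n, e m ω) * e n ω) + e n ω * e n ω) := fun ω => by
      rw [sum_range_succ]; ring
    simp_rw [hexp]
    have hi2 : Integrable (fun ω => 2 * ((∑ m ∈ range n, e m ω) * e n ω) + e n ω * e n ω) μ :=
      ((hSe n).const_mul 2).add (hprod n n)
    rw [integral_add (hSS n) hi2,
      integral_add ((hSe n).const_mul 2) (hprod n n), integral_const_mul]
    push_cast
    have : 2 * C / (1 - r) = 2 * (C / (1 - r)) := by ring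
    nlinarith

/-- The law of large numbers for bounded variables with exponentially decaying correlations. -/
theorem ae_tendsto_sum_div {D : ℕ → Ω → ℝ} (hm : ∀ n, Measurable (D n))
    (hb : ∀ n ω, |D n ω| ≤ 1) {C r : ℝ} (hC : 0 ≤ C) (hr0 : 0 ≤ r) (hr1 : r < 1)
    (hcov : ∀ m n, m < n → |∫ ω, D m ω * D n ω ∂μ - (∫ ω, D m ω ∂μ) * ∫ ω, D n ω ∂μ| ≤
      C * r ^ (n - m)) {v : ℝ} (hv : Tendsto (fun n => ∫ ω, D n ω ∂μ) atTop (𝓝 v)) :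
    ∀ᵐ ω ∂μ, Tendsto (fun n : ℕ => (∑ m ∈ range n, D m ω) / n) atTop (𝓝 v) := by
  have hi : ∀ n, Integrable (D n) μ := fun n =>
    .of_bound (hm n).aestronglyMeasurable 1 (.of_forall (hb n))
  have hprod : ∀ m n, Integrable (fun ω => D m ω * D n ω) μ := fun m n =>
    .of_bound ((hm m).mul (hm n)).aestronglyMeasurable 1 (.of_forall fun ω => by
      rw [Real.norm_eq_abs, abs_mul]
      exact mul_le_one₀ (hb m ω) (abs_nonneg _) (hb n ω))
  have hE : ∀ n, |∫ ω, D n ω ∂μ| ≤ 1 := fun n => by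
    have := norm_integral_le_of_norm_le_const (μ := μ) (f := D n) (C := 1) (.of_forall (hb n))
    simpa using this
  set e : ℕ → Ω → ℝ := fun n ω => D n ω - ∫ ω, D n ω ∂μ with he
  have hem : ∀ n, Measurable (e n) := fun n => (hm n).sub_const _
  have heb : ∀ n ω, |e n ω| ≤ 2 := fun n ω =>
    (abs_sub _ _).trans (by linarith [hb n ω, hE n])
  have hecov : ∀ m n, m < n → |∫ ω, e m ω * e n ω ∂μ| ≤ C * r ^ (n - m) := by
    intro m n hmn
    have : ∀ ω, e m ω * e n ω = D m ω * D n ω - ((∫ ω, D n ω ∂μ) * D m ω +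
        ((∫ ω, D m ω ∂μ) * D n ω - (∫ ω, D m ω ∂μ) * ∫ ω, D n ω ∂μ)) := fun ω => by
      simp only [he]; ring
    simp_rw [this]
    have h2 : Integrable (fun ω => (∫ ω, D m ω ∂μ) * D n ω -
        (∫ ω, D m ω ∂μ) * ∫ ω, D n ω ∂μ) μ := ((hi n).const_mul _).sub (integrable_const _)
    have h1 : Integrable (fun ω => (∫ ω, D n ω ∂μ) * D m ω + ((∫ ω, D m ω ∂μ) * D n ω -
        (∫ ω, D m ω ∂μ) * ∫ ω, D n ω ∂μ)) μ := ((hi m).const_mul _).add h2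
    rw [integral_sub (hprod m n) h1, integral_add ((hi m).const_mul _) h2, integral_sub ((hi n).const_mul _) (integrable_const _),
      integral_const_mul, integral_const_mul, integral_const, probReal_univ, one_smul]
    have h := hcov m n hmn
    convert h using 2
    ring
  have hSb : ∀ (n : ℕ) ω, |∑ m ∈ range n, e m ω| ≤ n * 2 := fun n ω => by
    refine (abs_sum_le_sum_abs _ _).trans ((sum_le_card_nsmul _ _ 2 fun m _ => heb m ω).trans ?_)
    simp
  have hSm : ∀ n : ℕ, Measurable fun ω => ∑ m ∈ range n, e m ω := fun n =>
    Finset.measurable_sum _ fun m _ => hem m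
  have hsq := ae_tendsto_div_sq (μ := μ) (S := fun n ω => ∑ m ∈ range n, e m ω) hSm
    (fun n => .of_bound ((hSm n).pow_const 2).aestronglyMeasurable ((n * 2) ^ 2)
      (.of_forall fun ω => by
        rw [Real.norm_eq_abs, abs_pow]
        exact pow_le_pow_left₀ (abs_nonneg _) (hSb n ω) 2))
    (integral_sq_sum_le hem heb hC hr0 hr1 hecov)
  have hsqlim : Tendsto (fun n : ℕ => (n + 1) ^ 2) atTop atTop :=
    tendsto_atTop_mono (fun n => by simp only [id]; nlinarith) tendsto_id
  filter_upwards [hsq] with ω hω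
  have hces := hv.cesaro.comp hsqlim
  -- Adding `1` makes the summands nonnegative, so that convergence along the squares extends to all
  -- times by monotonicity.
  have hmono : Monotone fun n : ℕ => ∑ m ∈ range n, (D m ω + 1) := by
    refine monotone_nat_of_le_succ fun n => ?_
    rw [sum_range_succ]
    linarith [(abs_le.1 (hb n ω)).1]
  have hlim : Tendsto (fun n : ℕ => (∑ m ∈ range ((n + 1) ^ 2), (D m ω + 1)) /
      ((n + 1) ^ 2 : ℕ)) atTop (𝓝 (v + 1)) := by
    have := (hω.add hces).add_const 1
    rw [zero_add] at this
    refine this.congr fun n => ?_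
    have hpos : (((n + 1) ^ 2 : ℕ) : ℝ) ≠ 0 := by positivity
    simp only [Function.comp_apply, he, sum_sub_distrib, sum_add_distrib, sum_const, card_range,
      nsmul_eq_mul, mul_one]
    rw [inv_mul_eq_div, sub_div, sub_add_cancel, add_div, div_self hpos]
  have hall := tendsto_div_of_monotone_of_exists_subseq_tendsto_div _ (v + 1) hmono fun a ha => by
    refine ⟨fun n => (n + 1) ^ 2, ?_, hsqlim, hlim⟩
    -- The ratio of consecutive squares tends to `1`, hence is eventually below any `a > 1`.
    have h1 : Tendsto (fun n : ℕ => (1 + 1 / ((n : ℝ) + 1)) ^ 2) atTop (𝓝 ((1 + 0) ^ 2)) :=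
      (tendsto_one_div_add_atTop_nhds_zero_nat.const_add 1).pow 2
    filter_upwards [h1.eventually (gt_mem_nhds (by simpa using ha))] with n hn
    have h2 : (0 : ℝ) < ((n : ℝ) + 1) ^ 2 := by positivity
    have h3 : (((n + 1 + 1) ^ 2 : ℕ) : ℝ) = (1 + 1 / ((n : ℝ) + 1)) ^ 2 * ((n : ℝ) + 1) ^ 2 := by
      push_cast; field_simp
    rw [h3]; push_cast
    exact mul_le_mul_of_nonneg_right hn.le h2.le
  have := hall.sub_const 1
  rw [add_sub_cancel_right] at this
  refine this.congr' ?_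
  filter_upwards [eventually_ge_atTop 1] with n hn
  have hpos : (n : ℝ) ≠ 0 := by positivity
  simp only [sum_add_distrib, sum_const, card_range, nsmul_eq_mul, mul_one]
  rw [add_div, div_self hpos, add_sub_cancel_right]

end LawOfLargeNumbers

/-! ### The speed of the exploring walk -/

section Speed

variable {g : ℕ → ℝ} {q : ℝ} (p : PMF ℕ)

theorem abs_incr (n : ℕ) (ω : Driver) : |incr g ω n| = 1 := by
  rcases incr_eq (g := g) (ω := ω) n with e | e <;> simp [e]

theorem integral_comp_shift {f : Driver → ℝ} (hf : Measurable f) (k : ℕ) :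
    ∫ ω, f (shift k ω) ∂driverLaw p = ∫ ω, f ω ∂driverLaw p := by
  conv_rhs => rw [← map_shift_driverLaw p k]
  rw [integral_map (measurable_shift k).aemeasurable hf.aestronglyMeasurable]

/-- The integrands agree when there is a cut time between `a` and `n + 1`, and otherwise differ by
at most `2`. -/
theorem abs_integral_mul_incr_sub_le (h0 : 0 ≤ q) (h1 : q ≤ 1 / 9) (hg : ∀ k, g k ≤ q) {a n : ℕ}
    (han : a ≤ n) {f : Driver → ℝ} (hf : Measurable f) (hb : ∀ ω, |f ω| ≤ 1) :
    |∫ ω, f ω * incr g ω n ∂driverLaw p - ∫ ω, f ω * incr g (shift a ω) (n - a) ∂driverLaw p| ≤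
      2 * ((1 + 3 * q) * ((1 + 7 * q) / 2) ^ (n + 1 - a)) := by
  set N : Set Driver := {ω | ∀ k, a ≤ k → k ≤ n + 1 → ¬ IsCut q ω k (n + 1)} with hN
  have hm : MeasurableSet N := by
    simp only [hN, Set.ofPred_forall]
    exact .iInter fun k => .iInter fun _ => .iInter fun _ => (measurableSet_isCut k _).compl
  have hfb : BoundedMeasurable f := ⟨hf, 1, hb⟩
  have hs : BoundedMeasurable fun ω => incr g (shift a ω) (n - a) :=
    ⟨(measurable_incr _).comp (measurable_shift a), 1, fun ω => (abs_incr _ _).le⟩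
  have hn : BoundedMeasurable fun ω => incr g ω n :=
    ⟨measurable_incr _, 1, fun ω => (abs_incr _ _).le⟩
  rw [← integral_sub ((hfb.mul hn).integrable p) ((hfb.mul hs).integrable p)]
  refine abs_integral_le_integral_abs.trans ?_
  have hpt : ∀ ω, |f ω * incr g ω n - f ω * incr g (shift a ω) (n - a)| ≤ 2 * N.indicator 1 ω := by
    intro ω
    by_cases hω : ω ∈ N
    · rw [Set.indicator_of_mem hω, ← mul_sub, abs_mul]
      have h2 : |incr g ω n - incr g (shift a ω) (n - a)| ≤ 2 :=
        (abs_sub _ _).trans (by rw [abs_incr, abs_incr]; norm_num)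
      calc _ ≤ 1 * 2 := mul_le_mul (hb ω) h2 (abs_nonneg _) zero_le_one
        _ = _ := by simp
    · rw [Set.indicator_of_notMem hω]
      simp only [hN, Set.mem_ofPred_eq, not_forall, not_not] at hω
      obtain ⟨k, hk1, hk2, hk3⟩ := hω
      rw [incr_eq_incr_shift hg hk1 han hk2 hk3]
      simp
  have hint : Integrable (N.indicator (1 : Driver → ℝ)) (driverLaw p) :=
    (integrable_const (1 : ℝ)).indicator hm
  refine (integral_mono (((hfb.mul hn).sub (hfb.mul hs)).integrable p).abs
    (hint.const_mul 2) hpt).trans ?_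
  rw [integral_const_mul, integral_indicator_one hm]
  exact mul_le_mul_of_nonneg_left
    (measureReal_forall_not_isCut_le p h0 h1 (by omega)) (by norm_num)

theorem abs_integral_incr_sub_le (h0 : 0 ≤ q) (h1 : q ≤ 1 / 9) (hg : ∀ k, g k ≤ q) {a n : ℕ}
    (han : a ≤ n) :
    |∫ ω, incr g ω n ∂driverLaw p - ∫ ω, incr g ω (n - a) ∂driverLaw p| ≤
      2 * ((1 + 3 * q) * ((1 + 7 * q) / 2) ^ (n + 1 - a)) := by
  have := abs_integral_mul_incr_sub_le p h0 h1 hg han (f := fun _ => 1) measurable_const (by simp)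
  simp only [one_mul] at this
  rwa [integral_comp_shift p (measurable_incr (g := g) (n - a)) a] at this

/-- Forgetting just the first time unit compares the means at `n + 1` and `n` with a geometric
error, so the means form a Cauchy sequence. -/
theorem exists_tendsto_integral_incr (h0 : 0 ≤ q) (h1 : q ≤ 1 / 9) (hg : ∀ k, g k ≤ q) :
    ∃ v, Tendsto (fun n => ∫ ω, incr g ω n ∂driverLaw p) atTop (𝓝 v) := by
  refine cauchySeq_tendsto_of_complete (cauchySeq_of_le_geometric ((1 + 7 * q) / 2)
    (2 * (1 + 3 * q)) (by linarith) fun n => ?_)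
  have h := abs_integral_incr_sub_le p h0 h1 hg (show 1 ≤ n + 1 by omega)
  rw [dist_comm, Real.dist_eq]
  simp only [Nat.add_sub_cancel] at h
  refine h.trans ?_
  have : ((1 + 7 * q) / 2) ^ (n + 1) ≤ ((1 + 7 * q) / 2) ^ n :=
    pow_le_pow_of_le_one (by positivity) (by linarith) (Nat.le_succ n)
  nlinarith

/-- Replace the increment at `n` by that of the walk restarted at `m + 1`, which is independent of
the increment at `m`. The replacement is made once in the mixed moment and once in the product of
means, whence the constant `4`. -/
theorem abs_covariance_incr_le (h0 : 0 ≤ q) (h1 : q ≤ 1 / 9) (hg : ∀ k, g k ≤ q) {m n : ℕ}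
    (hmn : m < n) :
    |∫ ω, incr g ω m * incr g ω n ∂driverLaw p -
      (∫ ω, incr g ω m ∂driverLaw p) * ∫ ω, incr g ω n ∂driverLaw p| ≤
      4 * (1 + 3 * q) * ((1 + 7 * q) / 2) ^ (n - m) := by
  have hE : |∫ ω, incr g ω m ∂driverLaw p| ≤ 1 := by
    have := norm_integral_le_of_norm_le_const (μ := driverLaw p) (f := fun ω => incr g ω m) (C := 1)
      (.of_forall fun ω => (abs_incr m ω).le)
    simpa using this
  have h2 := abs_integral_mul_incr_sub_le p h0 h1 hg (show m + 1 ≤ n by omega)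
    (measurable_incr (g := g) m) (fun ω => (abs_incr m ω).le)
  have h3 := abs_integral_incr_sub_le p h0 h1 hg (show m + 1 ≤ n by omega)
  have h4 := integral_mul_of_dependsOn p (measurable_incr (g := g) m)
    ((measurable_incr (g := g) (n - (m + 1))).comp (measurable_shift (m + 1)))
    (dependsOn_incr m) (dependsOn_comp_shift (fun ω => incr g ω (n - (m + 1))) (m + 1))
    (Set.disjoint_left.2 fun i (hi : i.1 ≤ m) (hi' : m + 1 ≤ i.1) => by omega)
  simp only [Function.comp_def] at h4
  rw [integral_comp_shift p (measurable_incr (g := g) _)] at h4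
  rw [h4] at h2
  rw [show n + 1 - (m + 1) = n - m by omega] at h2 h3
  have h5 := mul_le_mul hE h3 (abs_nonneg _) zero_le_one
  rw [← abs_mul, one_mul] at h5
  have e : ∫ ω, incr g ω m * incr g ω n ∂driverLaw p -
      (∫ ω, incr g ω m ∂driverLaw p) * ∫ ω, incr g ω n ∂driverLaw p =
      (∫ ω, incr g ω m * incr g ω n ∂driverLaw p - (∫ ω, incr g ω m ∂driverLaw p) *
        ∫ ω, incr g ω (n - (m + 1)) ∂driverLaw p) - (∫ ω, incr g ω m ∂driverLaw p) *
      (∫ ω, incr g ω n ∂driverLaw p - ∫ ω, incr g ω (n - (m + 1)) ∂driverLaw p) := by ring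
  rw [e]
  refine (abs_sub _ _).trans ?_
  linarith

theorem sum_incr (ω : Driver) (n : ℕ) : ∑ m ∈ range n, incr g ω m = (pos g ω n).length := by
  simp only [incr]
  rw [sum_range_sub (fun m => ((pos g ω m).length : ℝ))]
  simp [pos_zero]

theorem ae_tendsto_length_div (h0 : 0 ≤ q) (h1 : q ≤ 1 / 9) (hg : ∀ k, g k ≤ q) {v : ℝ}
    (hv : Tendsto (fun n => ∫ ω, incr g ω n ∂driverLaw p) atTop (𝓝 v)) :
    ∀ᵐ ω ∂driverLaw p, Tendsto (fun n : ℕ => ((pos g ω n).length : ℝ) / n) atTop (𝓝 v) := by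
  have := ae_tendsto_sum_div (μ := driverLaw p) (D := fun n ω => incr g ω n)
    (fun n => measurable_incr n) (fun n ω => (abs_incr n ω).le)
    (C := 4 * (1 + 3 * q)) (r := (1 + 7 * q) / 2) (by positivity) (by positivity) (by linarith)
    (fun m n hmn => abs_covariance_incr_le p h0 h1 hg hmn) hv
  simpa only [sum_incr] using this

end Speed

/-! ### The law of the exploring walk -/

section Law

/-- The probability that the `β`-biased walk steps back from a vertex with `k` children, where `k` is
at least `d`. -/
noncomputable def backProb (β : ℝ≥0) (d k : ℕ) : ℝ := 1 / (1 + β * max k d)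

theorem backProb_of_le {β : ℝ≥0} {d k : ℕ} (h : d ≤ k) :
    ENNReal.ofReal (backProb β d k) = ((1 / (1 + β * k) : ℝ≥0) : ℝ≥0∞) := by
  have : backProb β d k = ((1 / (1 + β * k) : ℝ≥0) : ℝ) := by
    rw [backProb, max_eq_left h]; push_cast; rfl
  rw [this, ENNReal.ofReal_coe_nnreal]

theorem backProb_nonneg (β : ℝ≥0) (d k : ℕ) : 0 ≤ backProb β d k := by
  unfold backProb; positivity

theorem backProb_le_one (β : ℝ≥0) (d k : ℕ) : backProb β d k ≤ 1 := by
  rw [backProb, div_le_one (by positivity)]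
  have : (0 : ℝ) ≤ β * max k d := by positivity
  linarith

theorem le_of_apply_ne_zero {p : PMF ℕ} (hp : p 0 = 0) {k : ℕ} (hk : p k ≠ 0) :
    1 ≤ k ∧ minDegree p ≤ k := by
  have h1 : 1 ≤ k := Nat.one_le_iff_ne_zero.2 fun h => hk (h ▸ hp)
  exact ⟨h1, Nat.sInf_le ⟨h1, pos_iff_ne_zero.2 hk⟩⟩

theorem one_le_minDegree {p : PMF ℕ} (hp : p 0 = 0) : 1 ≤ minDegree p := by
  obtain ⟨k, hk⟩ := p.support_nonempty
  have hk' := (p.mem_support_iff k).1 hk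
  exact (Nat.sInf_mem (s := {k : ℕ | 1 ≤ k ∧ 0 < p k})
    ⟨k, (le_of_apply_ne_zero hp hk').1, pos_iff_ne_zero.2 hk'⟩).1

theorem uniformLaw_floor {k : ℕ} (hk : 1 ≤ k) (j : ℕ) :
    uniformLaw {v | ⌊(k : ℝ) * v⌋₊ = j} = if j < k then (k : ℝ≥0∞)⁻¹ else 0 := by
  have hk0 : (0 : ℝ) < k := by exact_mod_cast hk
  have hm : MeasurableSet {v : ℝ | ⌊(k : ℝ) * v⌋₊ = j} :=
    (Nat.measurable_floor.comp (measurable_id.const_mul (k : ℝ))) (.singleton j)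
  have hset : {v : ℝ | ⌊(k : ℝ) * v⌋₊ = j} ∩ Set.Ico 0 1 =
      if j < k then Set.Ico ((j : ℝ) / k) ((j + 1) / k) else ∅ := by
    ext v
    simp only [Set.mem_inter_iff, Set.mem_ofPred_eq, Set.mem_Ico]
    constructor
    · rintro ⟨h, h0, h1⟩
      rw [Nat.floor_eq_iff (by positivity)] at h
      have hjk : j < k := by
        have : (j : ℝ) < k := h.1.trans_lt (by nlinarith)
        exact_mod_cast this
      rw [if_pos hjk, Set.mem_Ico, div_le_iff₀ hk0, lt_div_iff₀ hk0]
      constructor <;> linarith [h.1, h.2]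
    · split_ifs with hjk
      · rw [Set.mem_Ico, div_le_iff₀ hk0, lt_div_iff₀ hk0]
        rintro ⟨h1, h2⟩
        have hv0 : 0 ≤ v := by
          by_contra hv
          have : v * k < 0 := mul_neg_of_neg_of_pos (not_le.1 hv) hk0
          have : (0 : ℝ) ≤ j := Nat.cast_nonneg j
          linarith
        refine ⟨?_, hv0, ?_⟩
        · rw [Nat.floor_eq_iff (by positivity)]
          constructor <;> linarith
        · have : ((j : ℝ) + 1) ≤ k := by exact_mod_cast hjk
          by_contra hv
          nlinarith
      · intro h; exact absurd h (Set.notMem_empty v)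
  rw [uniformLaw, Measure.restrict_apply hm, hset]
  split_ifs
  · rw [Real.volume_Ico, show ((j : ℝ) + 1) / k - j / k = (k : ℝ)⁻¹ by field_simp; ring,
      ENNReal.ofReal_inv_of_pos hk0, ENNReal.ofReal_natCast]
  · simp

theorem uniformLaw_floor_cons {k : ℕ} (hk : 1 ≤ k) (x y : Vertex) :
    uniformLaw {v | ⌊(k : ℝ) * v⌋₊ :: x = y} =
      ∑ i ∈ range k, (k : ℝ≥0∞)⁻¹ * (if i :: x = y then 1 else 0) := by
  by_cases h : ∃ j, y = j :: x
  · obtain ⟨j, rfl⟩ := h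
    simp only [List.cons.injEq, and_true, mul_ite, mul_one, mul_zero]
    rw [uniformLaw_floor hk, sum_ite_eq']
    simp only [mem_range]
  · have h1 : {v : ℝ | ⌊(k : ℝ) * v⌋₊ :: x = y} = ∅ :=
      Set.eq_empty_of_forall_notMem fun v hv => h ⟨_, Eq.symm hv⟩
    rw [h1, measure_empty, sum_eq_zero]
    intro i _
    rw [if_neg fun hi => h ⟨i, hi.symm⟩, mul_zero]

theorem driverLaw_preimage (p : PMF ℕ) (i : ℕ × Fin 3) {s : Set ℝ} (hs : MeasurableSet s) :
    driverLaw p {ω | ω i ∈ s} = coordLaw p i.2 s :=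
  (measurePreserving_eval_infinitePi (fun i : ℕ × Fin 3 => coordLaw p i.2) i).measure_preimage
    hs.nullMeasurableSet

theorem coordLaw_of_ne (p : PMF ℕ) {c : Fin 3} (h : c ≠ 2) : coordLaw p c = uniformLaw := if_neg h

theorem measure_inter_of_dependsOn (p : PMF ℕ) {A B : Set Driver} (hA : MeasurableSet A)
    (hB : MeasurableSet B) {S T : Set (ℕ × Fin 3)} (hAS : DependsOn (fun ω => ω ∈ A) S)
    (hBT : DependsOn (fun ω => ω ∈ B) T) (hST : Disjoint S T) :
    driverLaw p (A ∩ B) = driverLaw p A * driverLaw p B := by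
  have h := (indepFun_of_dependsOn p (measurable_mem.2 hA) (measurable_mem.2 hB) hAS hBT
    hST).measure_inter_preimage_eq_mul {True} {True} (.singleton _) (.singleton _)
  have e : ∀ C : Set Driver, (fun ω => ω ∈ C) ⁻¹' {True} = C := fun C => by ext; simp
  rwa [e, e] at h

theorem driverLaw_offspring (p : PMF ℕ) (n k : ℕ) : driverLaw p {ω | offspring ω n = k} = p k := by
  have hs : MeasurableSet {x : ℝ | ⌊x⌋₊ = k} := Nat.measurable_floor (.singleton k)
  have := driverLaw_preimage p (n, 2) hs
  rw [coordLaw, if_pos rfl, Measure.map_apply measurable_from_top hs] at this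
  have e : (fun k : ℕ => (k : ℝ)) ⁻¹' {x : ℝ | ⌊x⌋₊ = k} = {k} := by ext; simp
  rw [e, PMF.toMeasure_apply_singleton _ _ (.singleton _)] at this
  exact this

/-- The law of the next position of the exploring walk. -/
theorem driverLaw_nextVertex (p : PMF ℕ) (β : ℝ≥0) {d k : ℕ} (hk : 1 ≤ k) (hd : d ≤ k)
    (ω' : Tree) (x y : Vertex) (hx : ω' x = k) (n : ℕ) :
    driverLaw p {ω | nextVertex (backProb β d) x k (ω (n, 0)) (ω (n, 1)) = y} =
      step β ω' x {y} := by
  have hfloor : ∀ x : Vertex, MeasurableSet {v : ℝ | ⌊(k : ℝ) * v⌋₊ :: x = y} := fun x =>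
    (measurable_from_top (f := fun i : ℕ => i :: x)).comp
      (Nat.measurable_floor.comp (measurable_id.const_mul (k : ℝ))) (.singleton y)
  have hv : ∀ x : Vertex, driverLaw p {ω | ⌊(k : ℝ) * ω (n, 1)⌋₊ :: x = y} =
      ∑ i ∈ range k, (k : ℝ≥0∞)⁻¹ * (if i :: x = y then 1 else 0) := fun x => by
    rw [← uniformLaw_floor_cons hk, ← coordLaw_of_ne p (show (1 : Fin 3) ≠ 2 by decide)]
    exact driverLaw_preimage p (n, 1) (hfloor x)
  have hk0 : (k : ℝ≥0) ≠ 0 := by exact_mod_cast (show k ≠ 0 by omega)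
  have hdirac : ∀ x : Vertex, Measure.dirac x {y} = if x = y then (1 : ℝ≥0∞) else 0 := fun x => by
    rw [Measure.dirac_apply' _ (.singleton _)]
    simp [Set.indicator]
  cases x with
  | nil =>
    have e : {ω : Driver | nextVertex (backProb β d) [] k (ω (n, 0)) (ω (n, 1)) = y} =
        {ω | ⌊(k : ℝ) * ω (n, 1)⌋₊ :: [] = y} := by
      simp [nextVertex]
    rw [e, hv, step, hx, if_neg (by omega)]
    simp only [Measure.finsetSum_apply, Measure.smul_apply, ENNReal.smul_def, smul_eq_mul, hdirac]
    rw [ENNReal.coe_inv hk0]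
    rfl
  | cons a x =>
    have e : {ω : Driver | nextVertex (backProb β d) (a :: x) k (ω (n, 0)) (ω (n, 1)) = y} =
        ({ω | ω (n, 0) < backProb β d k} ∩ {_ω | x = y}) ∪
        ({ω | ω (n, 0) < backProb β d k}ᶜ ∩ {ω | ⌊(k : ℝ) * ω (n, 1)⌋₊ :: a :: x = y}) := by
      ext ω
      by_cases h : ω (n, 0) < backProb β d k <;> simp [nextVertex, h]
    have hu : driverLaw p {ω | ω (n, 0) < backProb β d k} =
        ((1 / (1 + β * k) : ℝ≥0) : ℝ≥0∞) := by
      rw [← backProb_of_le hd, ← uniformLaw_Iio (backProb_le_one β d k),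
        ← coordLaw_of_ne p (show (0 : Fin 3) ≠ 2 by decide)]
      exact driverLaw_preimage p (n, 0) measurableSet_Iio
    have hum : MeasurableSet {ω : Driver | ω (n, 0) < backProb β d k} :=
      measurableSet_lt (measurable_pi_apply _) measurable_const
    have hvm : MeasurableSet {ω : Driver | ⌊(k : ℝ) * ω (n, 1)⌋₊ :: a :: x = y} :=
      (hfloor (a :: x)).preimage (f := fun ω : Driver => ω (n, 1)) (measurable_pi_apply _)
    have hindep := measure_inter_of_dependsOn p hum.compl hvm
      (S := {(n, 0)}) (T := {(n, 1)})
      (fun ω ω' h => by simp [h (n, 0) rfl]) (fun ω ω' h => by simp [h (n, 1) rfl])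
      (by simp)
    rw [e, measure_union _ (hum.compl.inter hvm), hindep, hv, prob_compl_eq_one_sub hum, hu, step, hx]
    · simp only [Measure.add_apply, Measure.finsetSum_apply, Measure.smul_apply, ENNReal.smul_def,
        smul_eq_mul, hdirac]
      congr 1
      · by_cases h : x = y
        · simp only [h, if_true, mul_one]
          rw [← hu]
          congr 1
          ext; simp
        · simp [h]
      · rw [mul_sum]
        refine sum_congr rfl fun i _ => ?_
        rw [← mul_assoc]
        congr 1
        -- What follows amounts to the identity `(1 - 1 / (1 + β k)) / k = β / (1 + β k)`.
        have hc : (1 - ((1 / (1 + β * k) : ℝ≥0) : ℝ≥0∞)) = ((1 - 1 / (1 + β * k) : ℝ≥0) : ℝ≥0∞) := by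
          push_cast; rfl
        have hk1 : ((k : ℝ≥0∞))⁻¹ = (((k : ℝ≥0)⁻¹ : ℝ≥0) : ℝ≥0∞) := by
          rw [ENNReal.coe_inv hk0]; rfl
        rw [hc, hk1, ← ENNReal.coe_mul, ENNReal.coe_inj]
        have h1 : (1 : ℝ≥0) / (1 + β * k) ≤ 1 := div_le_one_of_le₀ (by simp) (by positivity)
        refine NNReal.coe_injective ?_
        push_cast [NNReal.coe_sub h1]
        have : (k : ℝ) ≠ 0 := by exact_mod_cast hk0
        field_simp
        ring
    · exact Set.disjoint_left.2 fun ω h h' => h'.1 h.1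

variable {g : ℕ → ℝ}

theorem known_mono {ω : Driver} {i n : ℕ} (h : i ≤ n) {y : Vertex} {m : ℕ}
    (hy : known g ω i y = some m) : known g ω n y = some m := by
  induction n, h using Nat.le_induction with
  | base => exact hy
  | succ n _ ih => rw [known_succ, ih]; simp

/-- The event that the walk follows the path `x` and finds the numbers of children `κ`. -/
def followSet (g : ℕ → ℝ) (x : ℕ → Vertex) (κ : Vertex → ℕ) (n : ℕ) : Set Driver :=
  {ω | ∀ i ≤ n, pos g ω i = x i ∧ known g ω n (x i) = some (κ (x i))}

theorem measurableSet_followSet (x : ℕ → Vertex) (κ : Vertex → ℕ) (n : ℕ) :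
    MeasurableSet (followSet g x κ n) := by
  unfold followSet
  simp only [Set.ofPred_forall]
  exact .iInter fun i => .iInter fun _ =>
    ((measurableSet_explore i).1 _).inter ((measurableSet_explore n).2 _ _)

theorem dependsOn_followSet (x : ℕ → Vertex) (κ : Vertex → ℕ) (n : ℕ) :
    DependsOn (fun ω => ω ∈ followSet g x κ n) {i | i.1 < n ∨ i = (n, 2)} := by
  intro ω ω' h
  have h1 : known g ω n = known g ω' n := congrArg Prod.snd (dependsOn_explore (g := g) n h)
  have h2 : ∀ i ≤ n, pos g ω i = pos g ω' i := fun i hi =>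
    dependsOn_pos i fun j hj => h j (.inl (hj.trans_le hi))
  simp only [followSet, Set.mem_ofPred_eq, h1]
  exact propext (forall₂_congr fun i hi => by rw [h2 i hi])

/-- Returning to an explored vertex uses no new offspring variable. In the complementary case,
`followSet_succ_of_notMem`, exactly one fresh variable is read. -/
theorem followSet_succ_of_mem {x : ℕ → Vertex} {κ : Vertex → ℕ} {n : ℕ}
    (h : ∃ i ≤ n, x i = x (n + 1)) : followSet g x κ (n + 1) = followSet g x κ n ∩
      {ω | nextVertex g (x n) (κ (x n)) (ω (n, 0)) (ω (n, 1)) = x (n + 1)} := by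
  obtain ⟨l, hl, hxl⟩ := h
  ext ω
  simp only [followSet, Set.mem_ofPred_eq, Set.mem_inter_iff]
  constructor
  · intro H
    have hkn : ∀ i ≤ n, known g ω n (x i) = some (κ (x i)) := fun i hi => by
      have h1 := known_pos (g := g) (ω := ω) i
      rw [(H i (by omega)).1] at h1
      have h2 := known_mono (show i ≤ n + 1 by omega) h1
      rw [(H i (by omega)).2] at h2
      rw [known_mono hi h1, h2]
    refine ⟨fun i hi => ⟨(H i (by omega)).1, hkn i hi⟩, ?_⟩
    have h3 := (H (n + 1) le_rfl).1
    rwa [pos_succ, degree, (H n (by omega)).1, hkn n le_rfl] at h3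
  · rintro ⟨H, hnext⟩
    have hp : pos g ω (n + 1) = x (n + 1) := by
      rw [pos_succ, degree, (H n le_rfl).1, (H n le_rfl).2]; exact hnext
    intro i hi
    rcases Nat.lt_or_ge n i with hi' | hi'
    · obtain rfl : i = n + 1 := by omega
      exact ⟨hp, hxl ▸ known_mono (Nat.le_succ n) (H l hl).2⟩
    · exact ⟨(H i hi').1, known_mono (Nat.le_succ n) (H i hi').2⟩

theorem followSet_succ_of_notMem {x : ℕ → Vertex} {κ : Vertex → ℕ} {n : ℕ}
    (h : ¬ ∃ i ≤ n, x i = x (n + 1)) : followSet g x κ (n + 1) = followSet g x κ n ∩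
      {ω | nextVertex g (x n) (κ (x n)) (ω (n, 0)) (ω (n, 1)) = x (n + 1)} ∩
      {ω | offspring ω (n + 1) = κ (x (n + 1))} := by
  ext ω
  simp only [followSet, Set.mem_ofPred_eq, Set.mem_inter_iff]
  have hnone : (∀ i ≤ n, pos g ω i = x i) → known g ω n (x (n + 1)) = none := by
    intro H
    rcases hk : known g ω n (x (n + 1)) with _ | m
    · rfl
    · obtain ⟨i, hi, hpi, -⟩ := exists_of_known hk
      exact absurd ⟨i, hi, (H i hi).symm.trans hpi⟩ h
  constructor
  · intro H
    have hkn : ∀ i ≤ n, known g ω n (x i) = some (κ (x i)) := fun i hi => by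
      have h1 := known_pos (g := g) (ω := ω) i
      rw [(H i (by omega)).1] at h1
      have h2 := known_mono (show i ≤ n + 1 by omega) h1
      rw [(H i (by omega)).2] at h2
      rw [known_mono hi h1, h2]
    refine ⟨⟨fun i hi => ⟨(H i (by omega)).1, hkn i hi⟩, ?_⟩, ?_⟩
    · have h3 := (H (n + 1) le_rfl).1
      rwa [pos_succ, degree, (H n (by omega)).1, hkn n le_rfl] at h3
    · have h4 := (H (n + 1) le_rfl).2
      rw [known_succ, (H (n + 1) le_rfl).1, if_pos rfl,
        hnone fun i hi => (H i (by omega)).1] at h4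
      exact Option.some.inj h4
  · rintro ⟨⟨H, hnext⟩, hoff⟩
    have hp : pos g ω (n + 1) = x (n + 1) := by
      rw [pos_succ, degree, (H n le_rfl).1, (H n le_rfl).2]; exact hnext
    intro i hi
    rcases Nat.lt_or_ge n i with hi' | hi'
    · obtain rfl : i = n + 1 := by omega
      refine ⟨hp, ?_⟩
      rw [known_succ, hp, if_pos rfl, hnone fun i hi => (H i hi).1, Option.getD_none, hoff]
    · exact ⟨(H i hi').1, known_mono (Nat.le_succ n) (H i hi').2⟩

/-- Each distinct vertex of the path contributes its offspring probability once, and each step its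
transition probability. The same product is obtained for the biased walk in `averagedLaw_follow`. -/
theorem driverLaw_followSet {p : PMF ℕ} (hp : p 0 = 0) (β : ℝ≥0) (x : ℕ → Vertex)
    (κ : Vertex → ℕ) (n : ℕ) :
    driverLaw p (followSet (backProb β (minDegree p)) x κ n) =
      (∏ v ∈ (range (n + 1)).image x, p (κ v)) *
        ((if x 0 = [] then 1 else 0) * ∏ i ∈ range n, step β κ (x i) {x (i + 1)}) := by
  induction n with
  | zero =>
    by_cases h : x 0 = []
    · have : followSet (backProb β (minDegree p)) x κ 0 = {ω | offspring ω 0 = κ (x 0)} := by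
        ext ω
        simp [followSet, pos_zero, known_zero, h]
      rw [this, driverLaw_offspring]
      simp [h]
    · have : followSet (backProb β (minDegree p)) x κ 0 = ∅ := by
        refine Set.eq_empty_of_forall_notMem fun ω hω => h ?_
        exact ((hω 0 le_rfl).1.symm).trans pos_zero
      rw [this]
      simp [h]
  | succ n ih =>
    have himg : (range (n + 1 + 1)).image x = insert (x (n + 1)) ((range (n + 1)).image x) := by
      rw [range_add_one, image_insert]
    have hmemn : x n ∈ (range (n + 1)).image x := mem_image_of_mem x (by simp)
    -- The law of the next vertex is only correct for degrees at least `1` and `minDegree p`. Other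
    -- degrees have probability zero, and then both sides vanish.
    by_cases h0 : p (κ (x n)) = 0
    · have hA : driverLaw p (followSet (backProb β (minDegree p)) x κ n) = 0 := by
        rw [ih, prod_eq_zero hmemn h0, zero_mul]
      rw [himg, prod_eq_zero (mem_insert_of_mem hmemn) h0, zero_mul]
      refine measure_mono_null ?_ hA
      by_cases hx : ∃ i ≤ n, x i = x (n + 1)
      · rw [followSet_succ_of_mem hx]; exact Set.inter_subset_left
      · rw [followSet_succ_of_notMem hx]
        exact Set.inter_subset_left.trans Set.inter_subset_left
    · obtain ⟨hk1, hk2⟩ := le_of_apply_ne_zero hp h0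
      have hnm := measurable_nextVertex (g := backProb β (minDegree p)) (x n) (κ (x n)) n
        (.singleton (x (n + 1)))
      have hnd : DependsOn (fun ω : Driver => ω ∈ {ω : Driver | nextVertex (backProb β (minDegree p))
          (x n) (κ (x n)) (ω (n, 0)) (ω (n, 1)) = x (n + 1)}) {(n, 0), (n, 1)} := fun ω ω' h => by
        simp only [Set.mem_ofPred_eq, h (n, 0) (by simp), h (n, 1) (by simp)]
      have hd : Disjoint {i : ℕ × Fin 3 | i.1 < n ∨ i = (n, 2)} {(n, 0), (n, 1)} := by
        refine Set.disjoint_left.2 ?_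
        rintro i hi (rfl | rfl) <;> simp at hi
      have hstep := measure_inter_of_dependsOn p
        (measurableSet_followSet (g := backProb β (minDegree p)) x κ n) hnm
        (dependsOn_followSet x κ n) hnd hd
      have hlaw := driverLaw_nextVertex p β hk1 hk2 κ (x n) (x (n + 1)) rfl n
      have hstep' := hstep.trans (congrArg₂ (· * ·) ih hlaw)
      by_cases hx : ∃ i ≤ n, x i = x (n + 1)
      · have hmem : x (n + 1) ∈ (range (n + 1)).image x := by
          obtain ⟨i, hi, hxi⟩ := hx
          exact mem_image.2 ⟨i, mem_range.2 (by omega), hxi⟩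
        rw [followSet_succ_of_mem hx, himg, insert_eq_of_mem hmem, prod_range_succ _ n]
        refine hstep'.trans ?_
        ring
      · have hmem : x (n + 1) ∉ (range (n + 1)).image x := fun h => by
          obtain ⟨i, hi, hxi⟩ := mem_image.1 h
          exact hx ⟨i, by rw [mem_range] at hi; omega, hxi⟩
        have hoff := measure_inter_of_dependsOn p
          ((measurableSet_followSet (g := backProb β (minDegree p)) x κ n).inter hnm)
          (measurable_offspring (n + 1) (.singleton (κ (x (n + 1)))))
          (S := {i | i.1 < n + 1}) (T := {(n + 1, 2)}) (fun ω ω' h => by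
            have e1 := dependsOn_followSet (g := backProb β (minDegree p)) x κ n fun i hi => h i (by
              rcases hi with hi | rfl
              · exact Nat.lt_succ_of_lt hi
              · exact Nat.lt_succ_self n)
            have e2 := hnd fun i hi => h i (by
              rcases hi with rfl | hi
              · exact Nat.lt_succ_self n
              · rw [Set.mem_singleton_iff] at hi; subst hi; exact Nat.lt_succ_self n)
            exact congrArg₂ And e1 e2)
          (fun ω ω' h => by
            simp only [Set.mem_preimage, offspring, h (n + 1, 2) rfl])
          (Set.disjoint_left.2 fun i hi hi' => by
            rw [Set.mem_singleton_iff] at hi'; subst hi'; exact lt_irrefl (n + 1) hi)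
        rw [followSet_succ_of_notMem hx, himg, prod_insert hmem, prod_range_succ _ n]
        refine hoff.trans ((congrArg₂ (· * ·) hstep' (driverLaw_offspring p (n + 1) _)).trans ?_)
        ring

theorem averagedLaw_follow (p : PMF ℕ) (β : ℝ≥0) (x : ℕ → Vertex) (κ : Vertex → ℕ) (n : ℕ) :
    averagedLaw p β {η | ∀ i ≤ n, η.2 i = x i ∧ η.1 (x i) = κ (x i)} =
      (∏ v ∈ (range (n + 1)).image x, p (κ v)) *
        ((if x 0 = [] then 1 else 0) * ∏ i ∈ range n, step β κ (x i) {x (i + 1)}) := by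
  have hm : MeasurableSet {η : Tree × (ℕ → Vertex) | ∀ i ≤ n, η.2 i = x i ∧ η.1 (x i) = κ (x i)} := by
    simp only [Set.ofPred_forall]
    refine .iInter fun i => .iInter fun _ => .inter ?_ ?_
    · exact (MeasurableSet.singleton (x i)).preimage
        (f := fun η : Tree × (ℕ → Vertex) => η.2 i) ((measurable_pi_apply i).comp measurable_snd)
    · exact (MeasurableSet.singleton (κ (x i))).preimage
        (f := fun η : Tree × (ℕ → Vertex) => η.1 (x i))
        ((measurable_pi_apply (x i)).comp measurable_fst)
  set T : Set Tree := Set.pi ((range (n + 1)).image x) fun v => {κ v} with hT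
  have hTm : MeasurableSet T := .pi (Finset.countable_toSet _) fun v _ => .singleton _
  have hTiff : ∀ ω : Tree, ω ∈ T ↔ ∀ i ≤ n, ω (x i) = κ (x i) := fun ω => by
    simp [hT, Set.mem_pi]
  have key : ∀ ω, quenchedKernel β ω
      (Prod.mk ω ⁻¹' {η : Tree × (ℕ → Vertex) | ∀ i ≤ n, η.2 i = x i ∧ η.1 (x i) = κ (x i)}) =
      T.indicator (fun _ => (if x 0 = [] then 1 else 0) *
        ∏ i ∈ range n, step β κ (x i) {x (i + 1)}) ω := by
    intro ω
    by_cases hω : ω ∈ T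
    · have hω' := (hTiff ω).1 hω
      have e : Prod.mk ω ⁻¹' {η : Tree × (ℕ → Vertex) | ∀ i ≤ n, η.2 i = x i ∧
          η.1 (x i) = κ (x i)} = {ξ | ∀ i ≤ n, ξ i = x i} := by
        ext ξ
        simp only [Set.mem_preimage, Set.mem_ofPred_eq]
        exact ⟨fun h i hi => (h i hi).1, fun h i hi => ⟨h i hi, hω' i hi⟩⟩
      rw [e, Set.indicator_of_mem hω]
      refine (quenchedLaw_cylinder β ω n x).trans ?_
      congr 1
      refine prod_congr rfl fun i hi => ?_
      have hi' := hω' i (mem_range.1 hi).le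
      rcases hxi : x i with _ | ⟨a, y⟩ <;> rw [hxi] at hi' <;> simp only [step, hi']
    · rw [Set.indicator_of_notMem hω]
      have e : Prod.mk ω ⁻¹' {η : Tree × (ℕ → Vertex) | ∀ i ≤ n, η.2 i = x i ∧
          η.1 (x i) = κ (x i)} = ∅ := by
        refine Set.eq_empty_of_forall_notMem fun ξ hξ => hω ((hTiff ω).2 fun i hi => (hξ i hi).2)
      rw [e, measure_empty]
  rw [averagedLaw, Measure.compProd_apply hm, lintegral_congr key, lintegral_indicator_const hTm,
    mul_comm]
  congr 1
  rw [hT, galtonWatson, Measure.infinitePi_pi _ fun _ _ => .singleton _]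
  exact prod_congr rfl fun v _ => PMF.toMeasure_apply_singleton _ _ (.singleton _)

/-- A measure of a set is determined by the values of a countable family of coordinates on it. -/
theorem measure_eq_of_forall_fiber {α β γ : Type*} [MeasurableSpace α] [MeasurableSpace β]
    [Countable γ] [MeasurableSpace γ] [MeasurableSingletonClass γ] {μ : Measure α} {ν : Measure β}
    {A : Set α} {B : Set β} {f : α → γ} {h : β → γ} (hf : Measurable f) (hh : Measurable h)
    (H : ∀ c, μ (A ∩ f ⁻¹' {c}) = ν (B ∩ h ⁻¹' {c})) : μ A = ν B := by
  have : (μ.restrict A).map f = (ν.restrict B).map h := by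
    refine Measure.ext_of_singleton fun c => ?_
    rw [Measure.map_apply hf (.singleton c), Measure.map_apply hh (.singleton c),
      Measure.restrict_apply (hf (.singleton c)), Measure.restrict_apply (hh (.singleton c)),
      Set.inter_comm, H, Set.inter_comm]
  have h2 := congrArg (fun m => m Set.univ) this
  simpa [Measure.map_apply hf .univ, Measure.map_apply hh .univ] using h2

/-- Split both events according to the numbers of children at the finitely many vertices of the
path; the pieces have equal probabilities. -/
theorem driverLaw_path {p : PMF ℕ} (hp : p 0 = 0) (β : ℝ≥0) (x : ℕ → Vertex) (n : ℕ) :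
    driverLaw p {ω | ∀ i ≤ n, pos (backProb β (minDegree p)) ω i = x i} =
      averagedLaw p β {η | ∀ i ≤ n, η.2 i = x i} := by
  set g := backProb β (minDegree p) with hg
  have hmem : ∀ i ≤ n, x i ∈ (range (n + 1)).image x := fun i hi =>
    mem_image_of_mem x (mem_range.2 (Nat.lt_succ_of_le hi))
  refine measure_eq_of_forall_fiber (γ := (range (n + 1)).image x → ℕ)
    (f := fun ω v => (known g ω n v).getD 0) (h := fun η v => η.1 v) ?_ ?_ fun c => ?_
  · refine measurable_pi_lambda _ fun v => measurable_to_countable' fun k => ?_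
    have : (fun ω => (known g ω n v).getD 0) ⁻¹' {k} =
        ⋃ o : Option ℕ, {ω | known g ω n v = o} ∩ {_ω | o.getD 0 = k} := by
      ext ω; simp
    rw [this]
    exact .iUnion fun o => ((measurableSet_explore n).2 _ _).inter (.const _)
  · exact measurable_pi_lambda _ fun v => (measurable_pi_apply _).comp measurable_fst
  -- The value `0` off the path is irrelevant, since only vertices of the path are read.
  · set κ : Vertex → ℕ := fun v => if h : v ∈ (range (n + 1)).image x then c ⟨v, h⟩ else 0 with hκ
    have hκx : ∀ v : (range (n + 1)).image x, κ v = c v := fun v => by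
      rw [hκ]; simp only [v.2, dif_pos]
    have e1 : {ω | ∀ i ≤ n, pos g ω i = x i} ∩
        (fun ω (v : (range (n + 1)).image x) => (known g ω n v).getD 0) ⁻¹' {c} =
        followSet g x κ n := by
      ext ω
      simp only [Set.mem_inter_iff, Set.mem_ofPred_eq, Set.mem_preimage, Set.mem_singleton_iff,
        followSet]
      constructor
      · rintro ⟨h1, h2⟩ i hi
        refine ⟨h1 i hi, ?_⟩
        have h3 := known_pos (g := g) (ω := ω) i
        rw [h1 i hi] at h3
        have h4 := known_mono hi h3
        have h5 := congrFun h2 ⟨x i, hmem i hi⟩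
        simp only [h4, Option.getD_some] at h5
        rw [h4, h5, ← hκx]
      · intro H
        refine ⟨fun i hi => (H i hi).1, ?_⟩
        funext ⟨v, hv⟩
        obtain ⟨i, hi, rfl⟩ := mem_image.1 hv
        rw [(H i (Nat.lt_succ_iff.1 (mem_range.1 hi))).2, ← hκx]
        rfl
    have e2 : {η : Tree × (ℕ → Vertex) | ∀ i ≤ n, η.2 i = x i} ∩
        (fun η (v : (range (n + 1)).image x) => η.1 v) ⁻¹' {c} =
        {η | ∀ i ≤ n, η.2 i = x i ∧ η.1 (x i) = κ (x i)} := by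
      ext η
      simp only [Set.mem_inter_iff, Set.mem_ofPred_eq, Set.mem_preimage, Set.mem_singleton_iff]
      constructor
      · rintro ⟨h1, h2⟩ i hi
        refine ⟨h1 i hi, ?_⟩
        rw [hκx ⟨x i, hmem i hi⟩, ← h2]
      · intro H
        refine ⟨fun i hi => (H i hi).1, ?_⟩
        funext ⟨v, hv⟩
        obtain ⟨i, hi, rfl⟩ := mem_image.1 hv
        rw [← hκx]
        exact (H i (Nat.lt_succ_iff.1 (mem_range.1 hi))).2
    rw [e1, e2, averagedLaw_follow, hg, driverLaw_followSet hp]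

theorem measure_path_ext {μ ν : Measure (ℕ → Vertex)} [IsProbabilityMeasure μ]
    [IsProbabilityMeasure ν]
    (h : ∀ (x : ℕ → Vertex) n, μ {ξ | ∀ i ≤ n, ξ i = x i} = ν {ξ | ∀ i ≤ n, ξ i = x i}) :
    μ = ν := by
  have hmap : ∀ N, μ.map (Preorder.frestrictLe (π := fun _ => Vertex) N) =
      ν.map (Preorder.frestrictLe (π := fun _ => Vertex) N) := fun N => by
    refine Measure.ext_of_singleton fun y => ?_
    have e : Preorder.frestrictLe (π := fun _ => Vertex) N ⁻¹' {y} =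
        {ξ | ∀ i ≤ N, ξ i = if hi : i ≤ N then y ⟨i, mem_Iic.2 hi⟩ else []} := by
      ext ξ
      simp only [Set.mem_preimage, Set.mem_singleton_iff, Set.mem_ofPred_eq]
      constructor
      · rintro rfl i hi; simp [hi]
      · intro hξ; funext ⟨i, hi⟩; simpa [mem_Iic.1 hi] using hξ i (mem_Iic.1 hi)
    rw [Measure.map_apply (Preorder.measurable_frestrictLe _) (.singleton _),
      Measure.map_apply (Preorder.measurable_frestrictLe _) (.singleton _), e, h]
  refine ext_of_generate_finite _ generateFrom_measurableCylinders.symm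
    isPiSystem_measurableCylinders (fun t ht => ?_) (by simp)
  obtain ⟨N, S, mS, rfl⟩ : ∃ N S, MeasurableSet S ∧ t = cylinder (Iic N) S := by
    simpa [measurableCylinders_nat] using ht
  have h1 := congrArg (fun m => m S) (hmap N)
  simp only at h1
  rwa [Measure.map_apply (Preorder.measurable_frestrictLe _) mS,
    Measure.map_apply (Preorder.measurable_frestrictLe _) mS] at h1

theorem measurable_path : Measurable fun (ω : Driver) n => pos g ω n :=
  measurable_pi_lambda _ fun n => measurable_pos n

/-- The exploring walk has the law of the biased walk on the Galton-Watson tree. -/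
theorem map_snd_averagedLaw {p : PMF ℕ} (hp : p 0 = 0) (β : ℝ≥0) :
    (averagedLaw p β).map Prod.snd =
      (driverLaw p).map fun ω n => pos (backProb β (minDegree p)) ω n := by
  have : IsProbabilityMeasure (averagedLaw p β) := by unfold averagedLaw; infer_instance
  have h1 : IsProbabilityMeasure ((averagedLaw p β).map Prod.snd) :=
    Measure.isProbabilityMeasure_map measurable_snd.aemeasurable
  have h2 : IsProbabilityMeasure
      ((driverLaw p).map fun ω n => pos (backProb β (minDegree p)) ω n) :=
    Measure.isProbabilityMeasure_map measurable_path.aemeasurable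
  refine measure_path_ext fun x n => ?_
  have hm : MeasurableSet {ξ : ℕ → Vertex | ∀ i ≤ n, ξ i = x i} := by
    simp only [Set.ofPred_forall]
    exact .iInter fun i => .iInter fun _ =>
      (MeasurableSet.singleton (x i)).preimage (f := fun ξ : ℕ → Vertex => ξ i)
        (measurable_pi_apply i)
  rw [Measure.map_apply measurable_snd hm, Measure.map_apply measurable_path hm]
  exact (driverLaw_path hp β x n).symm

theorem isSpeed_iff {p : PMF ℕ} (hp : p 0 = 0) (β : ℝ≥0) (v : ℝ) :
    IsSpeed p β v ↔ ∀ᵐ ω ∂driverLaw p, Tendsto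
      (fun n : ℕ => ((pos (backProb β (minDegree p)) ω n).length : ℝ) / n) atTop (𝓝 v) := by
  have hm : MeasurableSet {ξ : ℕ → Vertex |
      Tendsto (fun n : ℕ => ((ξ n).length : ℝ) / n) atTop (𝓝 v)} := by
    refine measurableSet_tendsto _ fun n => ?_
    exact ((measurable_from_top (f := fun x : Vertex => (x.length : ℝ))).comp
      (measurable_pi_apply n)).div_const _
  have h1 := ae_map_iff (μ := averagedLaw p β) measurable_snd.aemeasurable hm
  rw [map_snd_averagedLaw hp, ae_map_iff measurable_path.aemeasurable hm] at h1
  exact h1.symm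

end Law

/-! ### Dependence of the backward probability on the bias and on the degree. -/

section Monotonicity

theorem bias_mul_minDegree_ge {p : PMF ℕ} (hp : p 0 = 0) {β : ℝ≥0}
    (hβ : 717 / (minDegree p : ℝ≥0) ≤ β) : (717 : ℝ) ≤ β * minDegree p := by
  have hd : (0 : ℝ≥0) < minDegree p := by exact_mod_cast one_le_minDegree hp
  rw [div_le_iff₀ hd] at hβ
  exact_mod_cast hβ

/-- The truncation `max k d` makes this hold for every `k`, also for degrees of probability zero, so
that the domination by the comparison walk is sure and not merely almost sure. -/
theorem backProb_le_backProb {β : ℝ≥0} {d k : ℕ} : backProb β d k ≤ backProb β d d := by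
  unfold backProb
  rw [max_self]
  have : d ≤ max k d := le_max_right _ _
  gcongr

theorem backProb_minDegree_le {p : PMF ℕ} (hp : p 0 = 0) {β : ℝ≥0}
    (hβ : 717 / (minDegree p : ℝ≥0) ≤ β) :
    backProb β (minDegree p) (minDegree p) ≤ 1 / 718 := by
  have := bias_mul_minDegree_ge hp hβ
  unfold backProb
  rw [max_self]
  exact one_div_le_one_div_of_le (by norm_num) (by linarith)

theorem backProb_lt_backProb {β β' : ℝ≥0} (h : β < β') {d : ℕ} (hd : 1 ≤ d) (k : ℕ) :
    backProb β' d k < backProb β d k := by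
  have h1 : (0 : ℝ) < (max k d : ℕ) := Nat.cast_pos.2 (lt_max_of_lt_right hd)
  have h2 : (β : ℝ) < β' := by exact_mod_cast h
  unfold backProb
  exact one_div_lt_one_div_of_lt (by positivity) (by nlinarith)

end Monotonicity

end BiasedWalk

/-! ### The main theorem. -/

open BiasedWalk in
theorem theorem2 (p : PMF ℕ) (hp : p 0 = 0) :
    ∃ v : ℝ≥0 → ℝ,
      (∀ β : ℝ≥0, 717 / (BiasedWalk.minDegree p : ℝ≥0) ≤ β → BiasedWalk.IsSpeed p β (v β)) ∧
        StrictMonoOn v (Set.Ici (717 / (BiasedWalk.minDegree p : ℝ≥0))) := by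
  set d := minDegree p with hd
  have hlim : ∀ β : ℝ≥0, ∃ v : ℝ, 717 / (d : ℝ≥0) ≤ β →
      Tendsto (fun n => ∫ ω, incr (backProb β d) ω n ∂driverLaw p) atTop (𝓝 v) := by
    intro β
    by_cases hβ : 717 / (d : ℝ≥0) ≤ β
    · have hq := backProb_minDegree_le hp hβ
      obtain ⟨v, hv⟩ := exists_tendsto_integral_incr (g := backProb β d) p (backProb_nonneg β d d)
        (by rw [← hd] at hq; linarith) fun _ => backProb_le_backProb
      exact ⟨v, fun _ => hv⟩
    · exact ⟨0, fun h => absurd h hβ⟩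
  choose v hv using hlim
  refine ⟨v, fun β hβ => ?_, fun β hβ β' hβ' hlt => ?_⟩
  · have hq := backProb_minDegree_le hp hβ
    rw [isSpeed_iff hp]
    exact ae_tendsto_length_div p (backProb_nonneg β d d) (by rw [← hd] at hq; linarith)
      (fun _ => backProb_le_backProb) (hv β hβ)
  · have hgg : ∀ k, backProb β' d k < backProb β d k :=
      backProb_lt_backProb hlt (one_le_minDegree hp)
    have hpos := separationProb_pos p (backProb_nonneg β' d) hgg (backProb_le_one β d)
    -- The comparison of means holds at the times `m + 1`, hence the shift. Its gain does not depend
    -- on `m` and therefore survives in the limit.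
    have hle : v β + separationProb p (backProb β d) (backProb β' d) ≤ v β' :=
      le_of_tendsto_of_tendsto' (((hv β hβ).comp (tendsto_add_atTop_nat 1)).add_const _)
        ((hv β' hβ').comp (tendsto_add_atTop_nat 1)) fun m =>
        integral_incr_add_le p (backProb_nonneg β d d) (backProb_minDegree_le hp hβ)
          (fun _ => backProb_le_backProb) (fun k => (hgg k).le) m
    linarith
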